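/- Let $\alpha>1/2$ be real, let $\boldsymbol\gamma=(\gamma_1,\gamma_2,\dots)$ satisfy $0\le\gamma_j\le 1$ for all $j$, and let $\eta\in(0,1)$. For $d\in\mathbb N$ and $\boldsymbol k\in\mathbb Z^d$ put $r_{\alpha,\boldsymbol\gamma}(\boldsymbol k)=\prod_{j:\,k_j\ne0}|k_j|^{\alpha}/\gamma_j\in[0,\infty]$ (a factor with $\gamma_j=0$ is $\infty$; the empty product is $1$). The weighted Korobov space $H_{\alpha,\boldsymbol\gamma}$ consists of the real functions $f$ on $[0,1]^d$, one-periodic in each variable, that are everywhere the sum of their absolutely convergent Fourier series $\sum_{\boldsymbol k}\hat f(\boldsymbol k)e^{2\pi i\boldsymbol k\cdot\boldsymbol x}$ and have finite norm $\|f\|_{\alpha,\boldsymbol\gamma}=\bigl(\sum_{\boldsymbol k}|\hat f(\boldsymbol k)|^2r_{\alpha,\boldsymbol\gamma}(\boldsymbol k)^2\bigr)^{1/2}$, where $0\cdot\infty=0$. Let $I(f)=\int_{[0,1]^d}f(\boldsymbol x)\,d\boldsymbol x$. For $N\ge2$ and $\boldsymbol z\in\{1,\dots,N-1\}^d$ let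 $Q_{N,\boldsymbol z}(f)=\frac1N\sum_{n=0}^{N-1}f(\{nz_1/N\},\dots,\{nz_d/N\})$, where $\{\cdot\}$ is the fractional part, and let $e^{\mathrm{wor}}(N,\boldsymbol z)=\sup_{\|f\|_{\alpha,\boldsymbol\gamma}\le1}|I(f)-Q_{N,\boldsymbol z}(f)|$. For integers $r\ge1$, $M\ge2$, the randomized lattice rule $A^{\mathrm{ran}}_{r,M}$ draws a prime $N$ uniformly from the primes $p$ with $\lceil M/2\rceil<p\le M$, then, given $N$, independent uniform vectors $\boldsymbol z_1,\dots,\boldsymbol z_r\in\{1,\dots,N-1\}^d$, lets $\boldsymbol z^*$ be one of them that minimizes $e^{\mathrm{wor}}(N,\boldsymbol z_j)$ (ties are broken arbitrarily), and uses $Q_{N,\boldsymbol z^*}$. Its worst-case randomized error is $$e^{\mathrm{ran}}(H_{\alpha,\boldsymbol\gamma};A^{\mathrm{ran}}_{r,M})=\sup_{\|f\|_{\alpha,\boldsymbol\gamma}\le1}\mathbb E\,|I(f)-Q_{N,\boldsymbol z^*}(f)| .$$ Call $M\ge 2$ admissible for $d$ if $$(1-\eta)M\ \ge\ \inf_{1/2\le\lambda<\alpha}2\prod_{j=1}^d\bigl(1+2\gamma_j^{1/\lambda}\zeta(\alpha/\lambda)\bigr),$$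 and take $$r=\left\lceil-\left(\alpha+\tfrac12\right)\frac{\log M}{\log(1-\eta)}\right\rceil .$$ Then: 1. For every $d$ and all $1/2<\lambda<\alpha$, $0<\delta<\min(\lambda-1/2,1)$ there is a constant $C>0$, independent of $M$ and of the tie-breaking, such that for all admissible $M$ $$e^{\mathrm{ran}}(H_{\alpha,\boldsymbol\gamma};A^{\mathrm{ran}}_{r,M})\le C\,M^{-\lambda+\delta-1/2}\log M .$$ 2. This is arbitrarily close to the order $M^{-\alpha-1/2}$: the exponent $-\lambda+\delta-1/2$ tends to $-\alpha-1/2$ as $\lambda\to\alpha^-$ and $\delta\to0^+$, and for every $d$ and every $\varepsilon>0$ there is a constant $C>0$ such that $e^{\mathrm{ran}}(H_{\alpha,\boldsymbol\gamma};A^{\mathrm{ran}}_{r,M})\le C\,M^{-\alpha-1/2+\varepsilon}$ for all admissible $M$. 3. If $\sum_{j=1}^\infty\gamma_j^{1/\alpha}<\infty$, then the constants in 1 and 2 can be chosen independently of $d$ (for each $d$, the bounds hold for all $M$ admissible for $d$). -/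

import Mathlib

open Set Filter Topology
open scoped BigOperators ENNReal

noncomputable section

namespace LatticeRule

/-- The integral `I(f)` of `f` over the unit cube `[0,1]^d`. -/
def cubeIntegral {d : ℕ} (f : (Fin d → ℝ) → ℝ) : ℝ :=
  ∫ x in Icc (0 : Fin d → ℝ) 1, f x

/-- The trigonometric monomial `exp(2πi k·x)`. -/
def trigMonomial {d : ℕ} (k : Fin d → ℤ) (x : Fin d → ℝ) : ℂ :=
  Complex.exp (2 * Real.pi * Complex.I * ((∑ j, (k j : ℝ) * x j : ℝ) : ℂ))

/-- The Fourier coefficient `∫_{[0,1]^d} f(x) exp(-2πi k·x) dx`. -/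
def fourierCoefficient {d : ℕ} (f : (Fin d → ℝ) → ℝ) (k : Fin d → ℤ) : ℂ :=
  ∫ x in Icc (0 : Fin d → ℝ) 1, (f x : ℂ) * trigMonomial (-k) x

/-- `r_{α,γ}(k) = ∏_{j, k_j ≠ 0} |k_j|^α / γ_j`, valued in `[0,∞]`; a factor with `γ_j = 0` is `∞`.
The weight of the coordinate `j : Fin d` (counted from `0`) is `γ j`. -/
def korobovWeight {d : ℕ} (α : ℝ) (γ : ℕ → ℝ) (k : Fin d → ℤ) : ℝ≥0∞ :=
  ∏ j, if k j = 0 then 1 else ENNReal.ofReal (|(k j : ℝ)| ^ α) / ENNReal.ofReal (γ j)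

/-- The Korobov norm `(∑_k |f̂(k)|² r_{α,γ}(k)²)^{1/2}`, valued in `[0,∞]`. Since `0 * ∞ = 0` there,
it is finite only if `f̂(k) = 0` whenever `r_{α,γ}(k) = ∞`. -/
def korobovNorm {d : ℕ} (α : ℝ) (γ : ℕ → ℝ) (f : (Fin d → ℝ) → ℝ) : ℝ≥0∞ :=
  (∑' k : Fin d → ℤ, (‖fourierCoefficient f k‖ₑ * korobovWeight α γ k) ^ 2) ^ (1 / 2 : ℝ)

/-- The weighted Korobov space (for `α > 1/2`): real functions that are one-periodic in each
variable, are everywhere the sum of their absolutely convergent Fourier series, and have finite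
norm. Functions on `[0,1]^d` are represented by their periodic extensions. -/
def korobovSpace (d : ℕ) (α : ℝ) (γ : ℕ → ℝ) : Set ((Fin d → ℝ) → ℝ) :=
  {f | (∀ x j, f (x + Pi.single j 1) = f x) ∧
    Summable (fun k => ‖fourierCoefficient f k‖) ∧
    (∀ x, HasSum (fun k => fourierCoefficient f k * trigMonomial k x) (f x : ℂ)) ∧
    korobovNorm α γ f < ∞}

/-- The unit ball of the weighted Korobov space. -/
def korobovBall (d : ℕ) (α : ℝ) (γ : ℕ → ℝ) : Set ((Fin d → ℝ) → ℝ) :=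
  {f | f ∈ korobovSpace d α γ ∧ korobovNorm α γ f ≤ 1}

/-- The rank-1 lattice rule with `N` points and generating vector `z`. -/
def latticeRule {d : ℕ} (N : ℕ) (z : Fin d → ℕ) (f : (Fin d → ℝ) → ℝ) : ℝ :=
  (1 / (N : ℝ)) * ∑ n ∈ Finset.range N, f (fun j => Int.fract ((n : ℝ) * (z j : ℝ) / (N : ℝ)))

/-- The deterministic worst-case error of the rank-1 lattice rule in the Korobov space. -/
def worstCaseError {d : ℕ} (α : ℝ) (γ : ℕ → ℝ) (N : ℕ) (z : Fin d → ℕ) : ℝ≥0∞ :=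
  ⨆ f ∈ korobovBall d α γ, ENNReal.ofReal |cubeIntegral f - latticeRule N z f|

/-- The primes `p` with `⌈M/2⌉ < p ≤ M`. -/
def primeRange (M : ℕ) : Finset ℕ :=
  (Finset.Ioc ⌈(M : ℝ) / 2⌉₊ M).filter Nat.Prime

/-- The set `{1, …, N-1}^d` of candidate generating vectors. -/
def candidates (d N : ℕ) : Finset (Fin d → ℕ) :=
  Fintype.piFinset fun _ => Finset.Icc 1 (N - 1)

/-- The possible outcomes of `r` draws `z_1, …, z_r` from `{1, …, N-1}^d`. Averaging uniformly over
this set amounts to drawing the `r` vectors independently and uniformly. -/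
def draws (d r N : ℕ) : Finset (Fin r → Fin d → ℕ) :=
  Fintype.piFinset fun _ => candidates d N

/-- `sel` is a rule (with an arbitrary way of breaking ties) that picks, for all outcomes of the
random draws, the index of a vector with minimal worst-case error among `z_1, …, z_r`. -/
def IsArgminRule (d : ℕ) (α : ℝ) (γ : ℕ → ℝ) (r M : ℕ)
    (sel : ℕ → (Fin r → Fin d → ℕ) → Fin r) : Prop :=
  ∀ N ∈ primeRange M, ∀ z ∈ draws d r N, ∀ j : Fin r,
    worstCaseError α γ N (z (sel N z)) ≤ worstCaseError α γ N (z j)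

/-- The worst-case randomized error of the randomized lattice rule: `N` is uniform on
`primeRange M`, then `z_1, …, z_r` are independent and uniform on `{1, …, N-1}^d`, and the lattice
rule with `N` points and the selected generating vector `z* = z (sel N z)` is applied. -/
def randomizedError (d : ℕ) (α : ℝ) (γ : ℕ → ℝ) (r M : ℕ)
    (sel : ℕ → (Fin r → Fin d → ℕ) → Fin r) : ℝ≥0∞ :=
  ⨆ f ∈ korobovBall d α γ, ENNReal.ofReal
    (𝔼 N ∈ primeRange M, 𝔼 z ∈ draws d r N, |cubeIntegral f - latticeRule N (z (sel N z)) f|)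

/-- The condition `(1-η) M ≥ inf_{1/2 ≤ lam < α} 2 ∏_{j ≤ d} (1 + 2 γ_j^{1/lam} ζ(α/lam))`. -/
def SizeCondition (d : ℕ) (α : ℝ) (γ : ℕ → ℝ) (η : ℝ) (M : ℕ) : Prop :=
  ⨅ lam : Ico (1 / 2 : ℝ) α, 2 * ∏ j : Fin d,
      (1 + 2 * γ j ^ (1 / (lam : ℝ)) * (riemannZeta ((α / (lam : ℝ) : ℝ) : ℂ)).re)
    ≤ (1 - η) * (M : ℝ)

/-- The number of draws `r = ⌈-(α+1/2) log M / log(1-η)⌉`. -/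
def numDraws (α η : ℝ) (M : ℕ) : ℕ :=
  ⌈-(α + 1 / 2) * Real.log M / Real.log (1 - η)⌉₊

/-- In dimension `d`, with `numDraws α η M` draws, the worst-case randomized error is at most
`bound M` for every admissible `M ≥ 2` and every way of breaking ties. -/
def ErrorBoundedBy (d : ℕ) (α : ℝ) (γ : ℕ → ℝ) (η : ℝ) (bound : ℕ → ℝ) : Prop :=
  ∀ M : ℕ, 2 ≤ M → SizeCondition d α γ η M →
    ∀ sel, IsArgminRule d α γ (numDraws α η M) M sel →
      randomizedError d α γ (numDraws α η M) M sel ≤ ENNReal.ofReal (bound M)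

end LatticeRule

end

/-! Write ρ(k) = 1/r(k). Averaging the Fourier series over the lattice leaves only the frequencies
of the dual lattice, so the error for `f` is at most the sum of |f̂(k)| over nonzero k with N ∣ k·z*
(`error_le`). Testing the rule on one cosine shows that each such k has ρ(k) at most the worst-case
error of z* (`invWeight_le_worstCaseError`).

Fix a threshold T of order 1/M. Averaging over z and Markov's inequality show that one draw has
worst-case error above T^λ with probability at most 1-η (`card_bad_candidates_le`). Hence all r
draws are bad with probability at most (1-η)^r ≤ M^(-α-1/2). Otherwise the minimizer z* is good, and
only k with ρ(k) ≤ T^λ matter.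

If N does not divide every entry of k, then k is dual to one of the r draws with probability at most
r/(N-1) (`card_draws_exists_mul_le`). Cauchy–Schwarz over the k with ρ(k) ≤ T^λ gives a factor
T^(λ-1/2). As r = O(log M), this part is O(M^(-λ-1/2) log M).

The k whose entries are all divisible by N are dual to every z, and here the random choice of N
helps: a k divisible by many primes is large. Cauchy–Schwarz, with k weighted by the number of
sampled primes dividing it, gives O(M^(-λ) P^(-1/2)) on average over the P primes
(`sum_multiples_le`), and P ≥ cM/log M (`exists_card_primeRange_ge`).

The constants depend on d only through the sums of ρ(k)^s with s > 1/α. These factor over the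
coordinates and are bounded uniformly in d when the γ_j^(1/α) are summable
(`invWeightSum_le_of_summable`). -/

noncomputable section

namespace LatticeRule

/-! ### A Chebyshev bound for the number of sampled primes -/

/-- The primes in `(n, 2n]` account for all but a subexponential-times-`4^(2n/3)` part of the
central binomial coefficient. -/
theorem centralBinom_le_mul_pow_card_primes (n : ℕ) (hn : 2 < n) :
    Nat.centralBinom n ≤ (2 * n) ^ Nat.sqrt (2 * n) * 4 ^ (2 * n / 3) *
      (2 * n) ^ ((Finset.Ioc n (2 * n)).filter Nat.Prime).card := by
  have n2_pos : 1 ≤ 2 * n := by omega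
  let f x := x ^ n.centralBinom.factorization x
  have hpow : ∀ p, f p ≤ 2 * n := fun p => Nat.pow_factorization_choose_le (by omega)
  have hone : ∀ p, p.Prime → 1 ≤ f p := fun p hp => Nat.one_le_pow _ _ hp.pos
  let U := {p ∈ Finset.range (2 * n + 1) | Nat.Prime p}
  let S := {p ∈ Finset.range (2 * n / 3 + 1) | Nat.Prime p}
  let T := (Finset.Ioc n (2 * n)).filter Nat.Prime
  have hU : n.centralBinom = ∏ p ∈ U, f p := by
    rw [← n.prod_pow_factorization_centralBinom]
    refine (Finset.prod_filter_of_ne fun p _ h => ?_).symm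
    contrapose h
    rw [Nat.factorization_eq_zero_of_not_prime n.centralBinom h, pow_zero]
  -- Primes in (2n/3, n] do not divide the central binomial coefficient, so only `S` and `T`
  -- contribute.
  have hU2 : ∏ p ∈ U, f p = ∏ p ∈ S ∪ T, f p := by
    symm
    apply Finset.prod_subset
    · intro p hp
      simp only [S, T, U, Finset.mem_union, Finset.mem_filter, Finset.mem_range,
        Finset.mem_Ioc] at hp ⊢
      rcases hp with h | h
      · exact ⟨by omega, h.2⟩
      · exact ⟨by omega, h.2⟩
    · intro p hp hp'
      simp only [S, T, U, Finset.mem_union, Finset.mem_filter, Finset.mem_range,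
        Finset.mem_Ioc] at hp hp'
      have h1 : ¬ p < 2 * n / 3 + 1 := fun h => hp' (Or.inl ⟨h, hp.2⟩)
      have h2 : p ≤ n := by
        by_contra h
        exact hp' (Or.inr ⟨by omega, hp.2⟩)
      have h3 : 2 * n < 3 * p := by omega
      simp only [f]
      rw [Nat.factorization_centralBinom_of_two_mul_self_lt_three_mul hn h2 h3, pow_zero]
  have hdisj : Disjoint S T := by
    rw [Finset.disjoint_left]
    intro p hp hp'
    simp only [S, T, Finset.mem_filter, Finset.mem_range, Finset.mem_Ioc] at hp hp'
    omega
  rw [hU, hU2, Finset.prod_union hdisj]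
  apply mul_le_mul'
  -- Each prime up to √(2n) contributes at most 2n. The larger ones occur to exponent at most 1, so
  -- a primorial bounds their product.
  · rw [← Finset.prod_filter_mul_prod_filter_not S (· ≤ Nat.sqrt (2 * n))]
    apply mul_le_mul'
    · refine (Finset.prod_le_prod' fun p _ => hpow p).trans ?_
      have : (Finset.Icc 1 (Nat.sqrt (2 * n))).card = Nat.sqrt (2 * n) := by
        rw [Nat.card_Icc, Nat.add_sub_cancel]
      rw [Finset.prod_const]
      refine pow_right_mono₀ n2_pos ((Finset.card_le_card fun x hx => ?_).trans this.le)
      obtain ⟨h1, h2⟩ := Finset.mem_filter.1 hx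
      exact Finset.mem_Icc.mpr ⟨(Finset.mem_filter.1 h1).2.one_lt.le, h2⟩
    · refine le_trans ?_ (primorial_le_four_pow (2 * n / 3))
      refine (Finset.prod_le_prod' fun p hp => (?_ : f p ≤ p)).trans ?_
      · obtain ⟨h1, h2⟩ := Finset.mem_filter.1 hp
        refine (pow_right_mono₀ (Finset.mem_filter.1 h1).2.one_lt.le ?_).trans (pow_one p).le
        exact Nat.factorization_choose_le_one (Nat.sqrt_lt'.mp <| not_le.1 h2)
      refine Finset.prod_le_prod_of_subset_of_one_le' (Finset.filter_subset _ _) ?_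
      exact fun p hp _ => (Finset.mem_filter.1 hp).2.one_lt.le
  · refine (Finset.prod_le_prod' fun p _ => hpow p).trans ?_
    rw [Finset.prod_const]

/-- Logarithms in 4^n ≤ 2n · `centralBinom n`: the factor 4^(2n/3) consumes two thirds of n log 4
and leaves the third that the primes in (n, 2n] must supply. -/
theorem log_centralBinom_bound (n : ℕ) (hn : 4 ≤ n) :
    (n : ℝ) * Real.log 4 / 3 - (Real.sqrt (2 * n) + 1) * Real.log (2 * n) ≤
      ((Finset.Ioc n (2 * n)).filter Nat.Prime).card * Real.log (2 * n) := by
  have h1 := (Nat.four_pow_lt_mul_centralBinom n hn).le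
  have h2 := centralBinom_le_mul_pow_card_primes n (by omega)
  set P := ((Finset.Ioc n (2 * n)).filter Nat.Prime).card
  have h3 : 4 ^ n ≤ (2 * n) * ((2 * n) ^ Nat.sqrt (2 * n) * 4 ^ (2 * n / 3) * (2 * n) ^ P) :=
    h1.trans (Nat.mul_le_mul (by omega) h2)
  have h4 : (4 : ℝ) ^ n ≤
      (2 * n) * ((2 * n) ^ Nat.sqrt (2 * n) * 4 ^ (2 * n / 3) * (2 * n) ^ P) := by
    exact_mod_cast h3
  have hn0 : (0 : ℝ) < 2 * n := by
    have : 0 < n := by omega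
    positivity
  have h5 := Real.log_le_log (by positivity) h4
  generalize hx : (2 : ℝ) * n = x at *
  rw [Real.log_mul (by positivity) (by positivity), Real.log_mul (by positivity) (by positivity),
    Real.log_mul (by positivity) (by positivity), Real.log_pow, Real.log_pow, Real.log_pow,
    Real.log_pow] at h5
  have h6 : ((2 * n / 3 : ℕ) : ℝ) ≤ x / 3 := by
    have := @Nat.cast_div_le ℝ _ _ _ (2 * n) 3
    push_cast at this
    rwa [hx] at this
  have h7 : (Nat.sqrt (2 * n) : ℝ) ≤ Real.sqrt x := by
    have := @Real.nat_sqrt_le_real_sqrt (2 * n)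
    push_cast at this
    rwa [hx] at this
  have hl4 : 0 ≤ Real.log 4 := Real.log_nonneg (by norm_num)
  have hl : 0 ≤ Real.log x := Real.log_nonneg (by
    have : (4 : ℝ) ≤ n := by exact_mod_cast hn
    linarith)
  nlinarith [mul_le_mul_of_nonneg_right h6 hl4, mul_le_mul_of_nonneg_right h7 hl]

theorem primeRange_eq {M : ℕ} (hM : 2 ≤ M) :
    ∃ n : ℕ, 0 < n ∧ M ≤ 2 * n ∧ 2 * n ≤ M + 1 ∧
      primeRange M = (Finset.Ioc n (2 * n)).filter Nat.Prime := by
  have hc : ⌈(M : ℝ) / 2⌉₊ = (M + 1) / 2 := by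
    rw [Nat.ceil_eq_iff (by omega)]
    have h1 : 2 * ((M + 1) / 2) ≤ M + 1 := by omega
    have h2 : M ≤ 2 * ((M + 1) / 2) := by omega
    have h1' : (2 : ℝ) * ((M + 1) / 2 : ℕ) ≤ M + 1 := by exact_mod_cast h1
    have h2' : (M : ℝ) ≤ 2 * ((M + 1) / 2 : ℕ) := by exact_mod_cast h2
    have h3 : 1 ≤ (M + 1) / 2 := by omega
    rw [Nat.cast_sub h3]
    push_cast at *
    constructor <;> linarith
  refine ⟨(M + 1) / 2, by omega, by omega, by omega, ?_⟩
  unfold primeRange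
  rw [hc]
  ext p
  simp only [Finset.mem_filter, Finset.mem_Ioc]
  constructor
  · rintro ⟨⟨h1, h2⟩, h3⟩
    exact ⟨⟨h1, by omega⟩, h3⟩
  · rintro ⟨⟨h1, h2⟩, h3⟩
    refine ⟨⟨h1, ?_⟩, h3⟩
    -- For odd M the interval gains only 2n = M + 1; an even prime is 2, which does not exceed M.
    by_contra h
    have hp : p = 2 * ((M + 1) / 2) := by omega
    have h4 : 2 ∣ p := ⟨_, hp⟩
    rw [Nat.prime_dvd_prime_iff_eq Nat.prime_two h3] at h4
    omega

theorem primeRange_nonempty {M : ℕ} (hM : 2 ≤ M) : (primeRange M).Nonempty := by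
  obtain ⟨n, hn, -, -, h⟩ := primeRange_eq hM
  rw [h]
  obtain ⟨p, hp, h1, h2⟩ := Nat.exists_prime_lt_and_le_two_mul n hn.ne'
  exact ⟨p, by simp [hp, h1, h2]⟩

theorem eventually_log_bound :
    ∀ᶠ n : ℕ in atTop, (Real.sqrt (2 * n) + 1) * Real.log (2 * n) ≤ (n : ℝ) / 10 := by
  have h1 : (fun x : ℝ => (Real.sqrt x + 1) * Real.log x) =o[atTop] fun x : ℝ => x := by
    have hs : (fun x : ℝ => Real.sqrt x + 1) =O[atTop] fun x : ℝ => x ^ (1 / 2 : ℝ) := by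
      simp only [Real.sqrt_eq_rpow]
      refine (Asymptotics.isBigO_refl _ _).add ?_
      refine Asymptotics.IsBigO.of_bound 1 ?_
      filter_upwards [eventually_ge_atTop 1] with x hx
      simp only [norm_one, one_mul]
      exact (Real.one_le_rpow hx (by norm_num)).trans (le_abs_self _)
    have hl := isLittleO_log_rpow_atTop (r := 1 / 2) (by norm_num)
    refine (hs.mul_isLittleO hl).congr' EventuallyEq.rfl ?_
    filter_upwards [eventually_gt_atTop 0] with x hx
    rw [← Real.rpow_add hx]
    norm_num
  have h2 := h1.bound (c := 1 / 20) (by norm_num)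
  have h3 : Tendsto (fun n : ℕ => (2 : ℝ) * n) atTop atTop :=
    tendsto_natCast_atTop_atTop.const_mul_atTop (by norm_num)
  filter_upwards [h3.eventually h2] with n hn
  have h4 := (le_abs_self _).trans hn
  rw [Real.norm_of_nonneg (by positivity)] at h4
  linarith

/-- A Chebyshev-type lower bound for the number of primes in `(⌈M/2⌉, M]`. -/
theorem exists_card_primeRange_ge :
    ∃ c : ℝ, 0 < c ∧ ∀ M : ℕ, 2 ≤ M → c * M / Real.log M ≤ (primeRange M).card := by
  obtain ⟨n₀, hn₀⟩ := eventually_atTop.1 eventually_log_bound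
  set A : ℝ := max n₀ 4
  have hA : 4 ≤ A := le_max_right _ _
  have hl2 : 0.6 < Real.log 2 := by linarith [Real.log_two_gt_d9]
  -- If n < A, then M < 2A and the single prime given by Bertrand's postulate suffices. Otherwise
  -- n/10 ≤ P log(2n) ≤ 2P log M with M ≤ 2n, hence 1/40.
  refine ⟨min (1 / 40) (Real.log 2 / (2 * A)), by positivity, fun M hM => ?_⟩
  have hMr : (2 : ℝ) ≤ M := by exact_mod_cast hM
  have hlM : Real.log 2 ≤ Real.log M := Real.log_le_log (by norm_num) hMr
  rw [div_le_iff₀ (by linarith)]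
  obtain ⟨n, hn, h1, h2, h⟩ := primeRange_eq hM
  have h1' : (M : ℝ) ≤ 2 * n := by exact_mod_cast h1
  have h2' : (2 : ℝ) * n ≤ M + 1 := by exact_mod_cast h2
  have hP1 : (1 : ℝ) ≤ (primeRange M).card := by
    exact_mod_cast Finset.card_pos.2 (primeRange_nonempty hM)
  by_cases hnA : (n : ℝ) < A
  · calc min (1 / 40) (Real.log 2 / (2 * A)) * M ≤ (Real.log 2 / (2 * A)) * (2 * A) := by
          apply mul_le_mul (min_le_right _ _) (by linarith) (by positivity) (by positivity)
      _ = Real.log 2 := by field_simp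
      _ ≤ 1 * Real.log M := by linarith
      _ ≤ _ := by gcongr
  · push Not at hnA
    have hn4 : 4 ≤ n := by exact_mod_cast (hA.trans hnA)
    have hnn : n₀ ≤ n := by exact_mod_cast ((le_max_left _ _).trans hnA)
    have h3 := log_centralBinom_bound n hn4
    have h4 := hn₀ n hnn
    rw [← h] at h3
    have hl4 : Real.log 4 = 2 * Real.log 2 := by
      rw [show (4 : ℝ) = 2 ^ 2 by norm_num, Real.log_pow]; norm_num
    have hn0 : (0 : ℝ) < n := by exact_mod_cast hn
    have h5 : (n : ℝ) / 10 ≤ (primeRange M).card * Real.log (2 * n) := by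
      rw [hl4] at h3
      nlinarith
    have h6 : Real.log (2 * n) ≤ 2 * Real.log M := by
      rw [show 2 * Real.log M = Real.log ((M : ℝ) ^ 2) by rw [Real.log_pow]; norm_num]
      apply Real.log_le_log (by positivity)
      nlinarith
    have h7 : (primeRange M).card * Real.log (2 * n) ≤
        (primeRange M).card * (2 * Real.log M) := by gcongr
    have h8 : min (1 / 40) (Real.log 2 / (2 * A)) * M ≤ 1 / 40 * M := by
      gcongr; exact min_le_left _ _
    linarith

/-! ### Reciprocal weights and their power sums -/

theorem ennreal_tsum_fin_prod {ι : Type*} {d : ℕ} (g : Fin d → ι → ℝ≥0∞) :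
    ∑' k : Fin d → ι, ∏ j, g j (k j) = ∏ j, ∑' n, g j n := by
  induction d with
  | zero => simp
  | succ d ih =>
    rw [← (Fin.consEquiv fun _ : Fin (d + 1) => ι).tsum_eq, ENNReal.tsum_prod', Fin.prod_univ_succ,
      ← ih]
    simp only [Fin.consEquiv_apply, Fin.prod_univ_succ, Fin.cons_zero, Fin.cons_succ,
      ENNReal.tsum_mul_left, ENNReal.tsum_mul_right]

/-- Cauchy–Schwarz for series in `[0,∞]`. -/
theorem ennreal_tsum_mul_le {ι : Type*} (u v : ι → ℝ≥0∞) :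
    ∑' i, u i * v i ≤ (∑' i, u i ^ 2) ^ (1 / 2 : ℝ) * (∑' i, v i ^ 2) ^ (1 / 2 : ℝ) := by
  let _ : MeasurableSpace ι := ⊤
  have h := ENNReal.lintegral_mul_le_Lp_mul_Lq
    (MeasureTheory.Measure.count : MeasureTheory.Measure ι)
    (p := 2) (q := 2) (Real.HolderConjugate.two_two) (f := u) (g := v)
    (measurable_from_top.aemeasurable) (measurable_from_top.aemeasurable)
  simpa [MeasureTheory.lintegral_count] using h

/-- The reciprocal `1 / r_{α,γ}(k)` of the Korobov weight. -/
def invWeight {d : ℕ} (α : ℝ) (γ : ℕ → ℝ) (k : Fin d → ℤ) : ℝ≥0∞ := (korobovWeight α γ k)⁻¹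

/-- The series `∑_k r_{α,γ}(k)^{-s}`. -/
def invWeightSum (d : ℕ) (α : ℝ) (γ : ℕ → ℝ) (s : ℝ) : ℝ≥0∞ :=
  ∑' k : Fin d → ℤ, invWeight α γ k ^ s

/-- No factor of the weight is 0, so inversion commutes with the product even when some factors are
∞; a vanishing γ_j gives the factor 0. -/
theorem invWeight_eq_prod {d : ℕ} {α : ℝ} {γ : ℕ → ℝ}
    (k : Fin d → ℤ) :
    invWeight α γ k = ∏ j, if k j = 0 then 1 else ENNReal.ofReal (γ j * |(k j : ℝ)| ^ (-α)) := by
  have hpos : ∀ j, k j ≠ 0 → (0 : ℝ) < |(k j : ℝ)| ^ α := fun j hj =>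
    Real.rpow_pos_of_pos (abs_pos.2 (by exact_mod_cast hj)) _
  have hne : ∀ j, (if k j = 0 then (1 : ℝ≥0∞) else
      ENNReal.ofReal (|(k j : ℝ)| ^ α) / ENNReal.ofReal (γ j)) ≠ 0 := by
    intro j
    split_ifs with h
    · exact one_ne_zero
    · exact (ENNReal.div_pos (by simpa using hpos j h) ENNReal.ofReal_ne_top).ne'
  unfold invWeight korobovWeight
  rw [ENNReal.prod_inv_distrib]
  · refine Finset.prod_congr rfl fun j _ => ?_
    split_ifs with h
    · simp
    · rw [ENNReal.inv_div (Or.inl ENNReal.ofReal_ne_top) (Or.inr (by simpa using hpos j h)),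
        Real.rpow_neg (abs_nonneg _), ← div_eq_mul_inv, ENNReal.ofReal_div_of_pos (hpos j h)]
  · exact fun i _ j _ _ => Or.inl (hne i)

theorem invWeight_le_of_ne_zero {d : ℕ} {α : ℝ} (hα : 0 < α) {γ : ℕ → ℝ}
    (hγ1 : ∀ j, γ j ≤ 1) (k : Fin d → ℤ) (j : Fin d) (hj : k j ≠ 0) :
    invWeight α γ k ≤ ENNReal.ofReal (|(k j : ℝ)| ^ (-α)) := by
  rw [invWeight_eq_prod]
  have hle : ∀ i, (if k i = 0 then (1 : ℝ≥0∞) else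
      ENNReal.ofReal (γ i * |(k i : ℝ)| ^ (-α))) ≤ 1 := by
    intro i
    split_ifs with h
    · exact le_rfl
    · rw [ENNReal.ofReal_le_one]
      have h1 : (1 : ℝ) ≤ |(k i : ℝ)| := by exact_mod_cast Int.one_le_abs h
      exact mul_le_one₀ (hγ1 i) (by positivity)
        (Real.rpow_le_one_of_one_le_of_nonpos h1 (by linarith))
  rw [← Finset.mul_prod_erase _ _ (Finset.mem_univ j), if_neg hj]
  calc _ ≤ ENNReal.ofReal (γ j * |(k j : ℝ)| ^ (-α)) * 1 := by
        gcongr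
        exact Finset.prod_le_one' fun i _ => hle i
    _ ≤ _ := by
        rw [mul_one]
        apply ENNReal.ofReal_le_ofReal
        exact mul_le_of_le_one_left (by positivity) (hγ1 j)

theorem korobovWeight_neg {d : ℕ} (α : ℝ) (γ : ℕ → ℝ) (k : Fin d → ℤ) :
    korobovWeight α γ (-k) = korobovWeight α γ k := by
  simp [korobovWeight]

/-- `∑_{n ≠ 0} |n|^{-t}` over the integers (the term at `0` vanishes). -/
def intZeta (t : ℝ) : ℝ := ∑' n : ℤ, |(n : ℝ)| ^ (-t)

theorem intZeta_nonneg (t : ℝ) : 0 ≤ intZeta t := tsum_nonneg fun _ => by positivity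

theorem invWeightSum_eq {d : ℕ} {α : ℝ} {γ : ℕ → ℝ} (hγ0 : ∀ j, 0 ≤ γ j) {s : ℝ} (hs : 0 < s)
    (hαs : 1 < α * s) :
    invWeightSum d α γ s = ENNReal.ofReal (∏ j : Fin d, (1 + γ j ^ s * intZeta (α * s))) := by
  have h1 : ∀ k : Fin d → ℤ, invWeight α γ k ^ s = ∏ j, (if k j = 0 then 1 else
      ENNReal.ofReal (γ j ^ s * |(k j : ℝ)| ^ (-(α * s)))) := by
    intro k
    rw [invWeight_eq_prod, ← ENNReal.prod_rpow_of_nonneg hs.le]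
    refine Finset.prod_congr rfl fun j _ => ?_
    split_ifs with h
    · simp
    · rw [ENNReal.ofReal_rpow_of_nonneg (mul_nonneg (hγ0 j) (by positivity)) hs.le,
        Real.mul_rpow (hγ0 j) (by positivity), ← Real.rpow_mul (abs_nonneg _), neg_mul]
  have h0 : -(α * s) ≠ 0 := by linarith
  unfold invWeightSum
  simp_rw [h1]
  rw [ennreal_tsum_fin_prod (fun (j : Fin d) (n : ℤ) => if n = 0 then (1 : ℝ≥0∞) else
      ENNReal.ofReal (γ j ^ s * |(n : ℝ)| ^ (-(α * s))))]
  rw [ENNReal.ofReal_prod_of_nonneg fun j _ => by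
    have := intZeta_nonneg (α * s)
    have := hγ0 j
    positivity]
  refine Finset.prod_congr rfl fun j _ => ?_
  -- Here 0 raised to the nonzero power -(αs) is 0, so the term n = 0 can be split off as a separate
  -- 1.
  have h2 : ∀ n : ℤ, (if n = 0 then (1 : ℝ≥0∞) else
      ENNReal.ofReal (γ j ^ s * |(n : ℝ)| ^ (-(α * s)))) = (if n = 0 then 1 else 0) +
      ENNReal.ofReal (γ j ^ s * |(n : ℝ)| ^ (-(α * s))) := by
    intro n
    split_ifs with h
    · simp [h, Real.zero_rpow h0]
    · simp
  simp_rw [h2]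
  rw [ENNReal.tsum_add, tsum_ite_eq, ENNReal.ofReal_add zero_le_one
    (mul_nonneg (Real.rpow_nonneg (hγ0 j) _) (intZeta_nonneg _)), ENNReal.ofReal_one, intZeta,
    ← tsum_mul_left, ENNReal.ofReal_tsum_of_nonneg]
  · intro n
    exact mul_nonneg (Real.rpow_nonneg (hγ0 j) _) (by positivity)
  · exact (Real.summable_abs_int_rpow hαs).mul_left _

/-- From 1 + x ≤ exp x in every factor; this is the source of the independence of the dimension. -/
theorem invWeightSum_le_of_summable {α : ℝ} {γ : ℕ → ℝ} (hγ0 : ∀ j, 0 ≤ γ j) {s : ℝ}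
    (hs : 0 < s) (hαs : 1 < α * s) (hsum : Summable fun j => γ j ^ s) (d : ℕ) :
    invWeightSum d α γ s ≤ ENNReal.ofReal (Real.exp ((∑' j, γ j ^ s) * intZeta (α * s))) := by
  rw [invWeightSum_eq hγ0 hs hαs]
  apply ENNReal.ofReal_le_ofReal
  have hz := intZeta_nonneg (α * s)
  have hp : ∀ j, 0 ≤ γ j ^ s := fun j => Real.rpow_nonneg (hγ0 j) _
  calc ∏ j : Fin d, (1 + γ j ^ s * intZeta (α * s))
      ≤ ∏ j : Fin d, Real.exp (γ j ^ s * intZeta (α * s)) := by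
        apply Finset.prod_le_prod
        · intro j _
          have := hp j
          positivity
        · intro j _
          rw [add_comm]
          exact Real.add_one_le_exp _
    _ = Real.exp ((∑ j ∈ Finset.range d, γ j ^ s) * intZeta (α * s)) := by
        rw [← Real.exp_sum, ← Finset.sum_mul, Finset.sum_range]
    _ ≤ _ := by
        gcongr
        exact hsum.sum_le_tsum _ fun j _ => hp j

/-- Every nonzero coordinate gains a factor N^(-α). One of them is kept, and the others are bounded
by 1. -/
theorem invWeight_smul_le {d : ℕ} {α : ℝ} (hα : 0 < α) {γ : ℕ → ℝ}
    {N : ℕ} (hN : 0 < N) {k : Fin d → ℤ} (hk : k ≠ 0) :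
    invWeight α γ (fun j => N * k j) ≤ ENNReal.ofReal ((N : ℝ) ^ (-α)) * invWeight α γ k := by
  obtain ⟨i, hi⟩ := Function.ne_iff.1 hk
  have hN' : (N : ℤ) ≠ 0 := by exact_mod_cast hN.ne'
  have hN1 : (1 : ℝ) ≤ N := by exact_mod_cast hN
  rw [invWeight_eq_prod, invWeight_eq_prod]
  rw [← Finset.mul_prod_erase _ _ (Finset.mem_univ i),
    ← Finset.mul_prod_erase Finset.univ (fun j => if k j = 0 then (1 : ℝ≥0∞) else
      ENNReal.ofReal (γ j * |(k j : ℝ)| ^ (-α))) (Finset.mem_univ i), ← mul_assoc]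
  have key : ∀ j : Fin d, ENNReal.ofReal (γ j * |((N * k j : ℤ) : ℝ)| ^ (-α)) =
      ENNReal.ofReal ((N : ℝ) ^ (-α)) * ENNReal.ofReal (γ j * |(k j : ℝ)| ^ (-α)) := by
    intro j
    rw [← ENNReal.ofReal_mul (by positivity)]
    push_cast
    rw [abs_mul, Nat.abs_cast, Real.mul_rpow (by positivity) (by positivity)]
    congr 1
    ring
  refine mul_le_mul' ?_ (Finset.prod_le_prod' fun j _ => ?_)
  · have hi' : k i ≠ 0 := hi
    rw [if_neg (mul_ne_zero hN' hi'), if_neg hi', key]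
  · by_cases h : k j = 0
    · simp [h]
    · rw [if_neg (mul_ne_zero hN' h), if_neg h, key]
      refine mul_le_of_le_one_left (zero_le) ?_
      rw [ENNReal.ofReal_le_one]
      exact Real.rpow_le_one_of_one_le_of_nonpos hN1 (by linarith)

/-- The part of `∑_k r_{α,γ}(k)^{-s}` over the nonzero multiples of `N`. -/
theorem tsum_invWeight_multiples_le {d : ℕ} {α : ℝ} (hα : 0 < α) {γ : ℕ → ℝ}
    {N : ℕ} (hN : 0 < N) {s : ℝ} (hs : 0 < s) :
    (∑' k : Fin d → ℤ, {k : Fin d → ℤ | k ≠ 0 ∧ ∀ j, (N : ℤ) ∣ k j}.indicator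
      (fun k => invWeight α γ k ^ s) k) ≤
      ENNReal.ofReal ((N : ℝ) ^ (-(α * s))) * invWeightSum d α γ s := by
  have hN' : (N : ℤ) ≠ 0 := by exact_mod_cast hN.ne'
  let φ : (Fin d → ℤ) → (Fin d → ℤ) := fun k j => N * k j
  have hφ : Function.Injective φ := by
    intro k l h
    ext j
    exact mul_left_cancel₀ hN' (congrFun h j)
  have hsupp : Function.support ({k : Fin d → ℤ | k ≠ 0 ∧ ∀ j, (N : ℤ) ∣ k j}.indicator
      (fun k => invWeight α γ k ^ s)) ⊆ Set.range φ := by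
    intro k hk
    have hk' := Set.support_indicator_subset hk
    choose l hl using hk'.2
    exact ⟨l, by ext j; simp [φ, hl j]⟩
  rw [← hφ.tsum_eq hsupp, invWeightSum, ← ENNReal.tsum_mul_left]
  refine ENNReal.tsum_le_tsum fun k => ?_
  by_cases hk : k = 0
  · subst hk
    have : φ 0 ∉ {k : Fin d → ℤ | k ≠ 0 ∧ ∀ j, (N : ℤ) ∣ k j} := by
      have h0 : φ 0 = 0 := by ext j; simp [φ]
      simp [h0]
    rw [Set.indicator_of_notMem this]
    exact zero_le
  · refine (Set.indicator_le_self' (fun _ _ => zero_le) _).trans ?_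
    calc invWeight α γ (φ k) ^ s ≤ (ENNReal.ofReal ((N : ℝ) ^ (-α)) * invWeight α γ k) ^ s :=
          ENNReal.rpow_le_rpow (invWeight_smul_le hα hN hk) hs.le
      _ = _ := by
          rw [ENNReal.mul_rpow_of_nonneg _ _ hs.le, ENNReal.ofReal_rpow_of_nonneg (by positivity)
            hs.le, ← Real.rpow_mul (by positivity), neg_mul]

/-! ### Fourier series under the lattice rule and the dual lattice -/

theorem trigMonomial_eq_prod {d : ℕ} (k : Fin d → ℤ) (x : Fin d → ℝ) :
    trigMonomial k x = ∏ j, Complex.exp (2 * Real.pi * Complex.I * (k j) * (x j)) := by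
  unfold trigMonomial
  rw [← Complex.exp_sum]
  push_cast
  rw [Finset.mul_sum]
  simp only [mul_assoc]

theorem trigMonomial_add {d : ℕ} (k l : Fin d → ℤ) (x : Fin d → ℝ) :
    trigMonomial (k + l) x = trigMonomial k x * trigMonomial l x := by
  simp only [trigMonomial_eq_prod, ← Finset.prod_mul_distrib, ← Complex.exp_add]
  refine Finset.prod_congr rfl fun j _ => ?_
  simp only [Pi.add_apply]
  push_cast
  ring_nf

theorem trigMonomial_zero {d : ℕ} (x : Fin d → ℝ) : trigMonomial 0 x = 1 := by
  simp [trigMonomial]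

theorem conj_trigMonomial {d : ℕ} (k : Fin d → ℤ) (x : Fin d → ℝ) :
    (starRingEnd ℂ) (trigMonomial k x) = trigMonomial (-k) x := by
  unfold trigMonomial
  rw [← Complex.exp_conj]
  congr 1
  simp [Complex.conj_ofNat]

theorem continuous_trigMonomial {d : ℕ} (k : Fin d → ℤ) :
    Continuous (trigMonomial k) := by
  unfold trigMonomial
  fun_prop

theorem integral_exp_two_pi_int (m : ℤ) :
    ∫ x in Icc (0 : ℝ) 1, Complex.exp (2 * Real.pi * Complex.I * m * x) =
      if m = 0 then 1 else 0 := by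
  rw [MeasureTheory.integral_Icc_eq_integral_Ioc, ← intervalIntegral.integral_of_le zero_le_one]
  split_ifs with h
  · simp [h]
  · have hc : (2 * Real.pi * Complex.I * m : ℂ) ≠ 0 := by
      have : (m : ℂ) ≠ 0 := by exact_mod_cast h
      simp [this, Real.pi_ne_zero]
    rw [integral_exp_mul_complex hc]
    have : Complex.exp (2 * Real.pi * Complex.I * m * (1 : ℝ)) = 1 := by
      rw [Complex.exp_eq_one_iff]
      exact ⟨m, by push_cast; ring⟩
    rw [this]
    simp

theorem integral_trigMonomial {d : ℕ} (k : Fin d → ℤ) :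
    ∫ x in Icc (0 : Fin d → ℝ) 1, trigMonomial k x = if k = 0 then 1 else 0 := by
  simp_rw [trigMonomial_eq_prod]
  rw [← Set.pi_univ_Icc, MeasureTheory.volume_pi, MeasureTheory.Measure.restrict_pi_pi,
    MeasureTheory.integral_fintype_prod_eq_prod (𝕜 := ℂ)
      (fun j (x : ℝ) => Complex.exp (2 * Real.pi * Complex.I * (k j) * x))]
  simp only [Pi.zero_apply, Pi.one_apply, integral_exp_two_pi_int]
  split_ifs with h
  · simp [h]
  · obtain ⟨i, hi⟩ := Function.ne_iff.1 h
    exact Finset.prod_eq_zero (Finset.mem_univ i) (if_neg hi)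

theorem integrableOn_trigMonomial {d : ℕ} (k : Fin d → ℤ) :
    MeasureTheory.IntegrableOn (trigMonomial k) (Icc (0 : Fin d → ℝ) 1) :=
  (continuous_trigMonomial k).continuousOn.integrableOn_compact isCompact_Icc

theorem cubeIntegral_eq {d : ℕ} (f : (Fin d → ℝ) → ℝ) :
    (cubeIntegral f : ℂ) = fourierCoefficient f 0 := by
  unfold cubeIntegral fourierCoefficient
  simp [trigMonomial_zero, integral_complex_ofReal]

/-- The nonzero elements of the dual lattice of the rank-1 lattice generated by `z`. -/
def dualSet {d : ℕ} (N : ℕ) (z : Fin d → ℕ) : Set (Fin d → ℤ) :=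
  {k | k ≠ 0 ∧ (N : ℤ) ∣ ∑ j, k j * z j}

/-- As k is integral, the integer parts drop out, and the node n contributes the n-th power of a
fixed root of unity. -/
theorem trigMonomial_lattice {d : ℕ} (N : ℕ) (z : Fin d → ℕ) (k : Fin d → ℤ)
    (n : ℕ) :
    trigMonomial k (fun j => Int.fract ((n : ℝ) * (z j : ℝ) / (N : ℝ))) =
      Complex.exp (2 * Real.pi * Complex.I * ((∑ j, k j * z j : ℤ) / N)) ^ n := by
  unfold trigMonomial
  rw [← Complex.exp_nat_mul, Complex.exp_eq_exp_iff_exists_int]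
  refine ⟨-∑ j, k j * ⌊(n : ℝ) * (z j : ℝ) / (N : ℝ)⌋, ?_⟩
  simp only [Int.fract]
  push_cast
  simp only [mul_sub, Finset.sum_sub_distrib]
  have : ∀ j, (k j : ℂ) * ((n : ℂ) * z j / N) = (n / N : ℂ) * (k j * z j) := fun j => by ring
  simp only [this, ← Finset.mul_sum]
  ring

theorem average_trigMonomial_lattice {d : ℕ} {N : ℕ} (hN : 0 < N) (z : Fin d → ℕ)
    (k : Fin d → ℤ) :
    (1 / (N : ℂ)) * ∑ n ∈ Finset.range N,
      trigMonomial k (fun j => Int.fract ((n : ℝ) * (z j : ℝ) / (N : ℝ))) =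
      if (N : ℤ) ∣ ∑ j, k j * z j then 1 else 0 := by
  have hN' : (N : ℂ) ≠ 0 := by exact_mod_cast hN.ne'
  simp_rw [trigMonomial_lattice N]
  set m : ℤ := ∑ j, k j * z j
  set ζ := Complex.exp (2 * Real.pi * Complex.I * (m / N))
  have hζ1 : ζ = 1 ↔ (N : ℤ) ∣ m := by
    rw [Complex.exp_eq_one_iff]
    have hpi : (2 * Real.pi * Complex.I : ℂ) ≠ 0 := Complex.two_pi_I_ne_zero
    constructor
    · rintro ⟨q, hq⟩
      rw [mul_comm (q : ℂ)] at hq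
      have := mul_left_cancel₀ hpi hq
      rw [div_eq_iff hN'] at this
      exact ⟨q, by rw [mul_comm]; exact_mod_cast this⟩
    · rintro ⟨q, hq⟩
      refine ⟨q, ?_⟩
      rw [hq]
      push_cast
      field_simp
  have hζN : ζ ^ N = 1 := by
    rw [← Complex.exp_nat_mul, Complex.exp_eq_one_iff]
    exact ⟨m, by field_simp⟩
  split_ifs with h
  · rw [hζ1.2 h]
    simp [hN']
  · rw [geom_sum_eq (fun h' => h (hζ1.1 h')), hζN]
    simp

/-- The Fourier series converges at every node, so it can be averaged termwise; the character sums
select k·z ≡ 0 mod N, and the term k = 0 is the integral. -/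
theorem hasSum_latticeRule {d : ℕ} {α : ℝ} {γ : ℕ → ℝ} {f : (Fin d → ℝ) → ℝ}
    (hf : f ∈ korobovSpace d α γ) {N : ℕ} (hN : 0 < N) (z : Fin d → ℕ) :
    HasSum ((dualSet N z).indicator (fourierCoefficient f))
      ((latticeRule N z f - cubeIntegral f : ℝ) : ℂ) := by
  have h1 : HasSum (fun k => (1 / (N : ℂ)) * ∑ n ∈ Finset.range N, fourierCoefficient f k *
      trigMonomial k (fun j => Int.fract ((n : ℝ) * (z j : ℝ) / (N : ℝ))))
      ((latticeRule N z f : ℝ) : ℂ) := by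
    unfold latticeRule
    push_cast
    exact (hasSum_sum fun n _ => hf.2.2.1 _).mul_left _
  have h2 := h1.sub (hasSum_ite_eq (0 : Fin d → ℤ) (fourierCoefficient f 0))
  rw [Complex.ofReal_sub, cubeIntegral_eq]
  refine (congrArg (HasSum · _) (funext fun k => ?_)).mpr h2
  rw [← Finset.mul_sum, mul_left_comm, average_trigMonomial_lattice hN]
  by_cases hk : k = 0
  · simp [hk, dualSet]
  · by_cases h : (N : ℤ) ∣ ∑ j, k j * z j
    · rw [Set.indicator_of_mem (show k ∈ dualSet N z from ⟨hk, h⟩)]; simp [hk, h]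
    · rw [Set.indicator_of_notMem (fun h' => h h'.2)]; simp [hk, h]

theorem error_le {d : ℕ} {α : ℝ} {γ : ℕ → ℝ} {f : (Fin d → ℝ) → ℝ}
    (hf : f ∈ korobovSpace d α γ) {N : ℕ} (hN : 0 < N) (z : Fin d → ℕ) :
    ENNReal.ofReal |cubeIntegral f - latticeRule N z f| ≤
      ∑' k, (dualSet N z).indicator (fun k => ‖fourierCoefficient f k‖ₑ) k := by
  have h := hasSum_latticeRule hf hN z
  have h1 : ENNReal.ofReal |cubeIntegral f - latticeRule N z f| =
      ‖((latticeRule N z f - cubeIntegral f : ℝ) : ℂ)‖ₑ := by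
    rw [← ofReal_norm, Complex.norm_real, Real.norm_eq_abs, abs_sub_comm]
  rw [h1, ← h.tsum_eq]
  refine enorm_tsum_le_tsum_enorm.trans (le_of_eq ?_)
  refine tsum_congr fun k => ?_
  rw [enorm_indicator_eq_indicator_enorm]

/-! ### Upper and lower bounds for the worst-case error -/

theorem ennreal_rpow_le_one_iff {x : ℝ≥0∞} {s : ℝ} (hs : 0 < s) : x ^ s ≤ 1 ↔ x ≤ 1 := by
  simpa using ENNReal.rpow_le_rpow_iff (x := x) (y := 1) hs

theorem korobovWeight_ne_zero {d : ℕ} (α : ℝ) (γ : ℕ → ℝ) (k : Fin d → ℤ) :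
    korobovWeight α γ k ≠ 0 := by
  unfold korobovWeight
  refine Finset.prod_ne_zero_iff.2 fun j _ => ?_
  split_ifs with h
  · exact one_ne_zero
  · have : (0 : ℝ) < |(k j : ℝ)| ^ α := Real.rpow_pos_of_pos (abs_pos.2 (by exact_mod_cast h)) _
    exact (ENNReal.div_pos (by simpa using this) ENNReal.ofReal_ne_top).ne'

theorem tsum_sq_le_one {d : ℕ} {α : ℝ} {γ : ℕ → ℝ} {f : (Fin d → ℝ) → ℝ}
    (hf : f ∈ korobovBall d α γ) :
    ∑' k, (‖fourierCoefficient f k‖ₑ * korobovWeight α γ k) ^ 2 ≤ 1 := by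
  have := hf.2
  unfold korobovNorm at this
  rwa [ennreal_rpow_le_one_iff (by norm_num)] at this

/-- The point is the case of infinite weight: the right side is then 0, and the norm bound forces
the coefficient to vanish. -/
theorem enorm_fourierCoefficient_le {d : ℕ} {α : ℝ} {γ : ℕ → ℝ} {f : (Fin d → ℝ) → ℝ}
    (hf : f ∈ korobovBall d α γ) (k : Fin d → ℤ) :
    ‖fourierCoefficient f k‖ₑ ≤
      (‖fourierCoefficient f k‖ₑ * korobovWeight α γ k) * invWeight α γ k := by
  by_cases hk : korobovWeight α γ k = ∞
  · have h1 : (‖fourierCoefficient f k‖ₑ * korobovWeight α γ k) ^ 2 ≤ 1 :=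
      (ENNReal.le_tsum k).trans (tsum_sq_le_one hf)
    by_cases h0 : ‖fourierCoefficient f k‖ₑ = 0
    · simp [h0]
    · rw [hk, ENNReal.mul_top h0] at h1
      simp at h1
  · rw [invWeight, mul_assoc, ENNReal.mul_inv_cancel (korobovWeight_ne_zero α γ k) hk, mul_one]

/-- Cauchy–Schwarz against the Fourier coefficients of an element of the unit ball. -/
theorem tsum_enorm_fourierCoefficient_mul_le {d : ℕ} {α : ℝ} {γ : ℕ → ℝ}
    {f : (Fin d → ℝ) → ℝ} (hf : f ∈ korobovBall d α γ) (v : (Fin d → ℤ) → ℝ≥0∞) :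
    ∑' k, ‖fourierCoefficient f k‖ₑ * v k ≤
      (∑' k, (invWeight α γ k * v k) ^ 2) ^ (1 / 2 : ℝ) := by
  calc ∑' k, ‖fourierCoefficient f k‖ₑ * v k
      ≤ ∑' k, (‖fourierCoefficient f k‖ₑ * korobovWeight α γ k) * (invWeight α γ k * v k) := by
        refine ENNReal.tsum_le_tsum fun k => ?_
        rw [← mul_assoc]
        exact mul_le_mul_left (enorm_fourierCoefficient_le hf k) _
    _ ≤ _ := ennreal_tsum_mul_le _ _
    _ ≤ 1 * _ := by
        gcongr
        exact ENNReal.rpow_le_one (tsum_sq_le_one hf) (by norm_num)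
    _ = _ := one_mul _

theorem worstCaseError_le {d : ℕ} (α : ℝ) (γ : ℕ → ℝ) {N : ℕ} (hN : 0 < N) (z : Fin d → ℕ) :
    worstCaseError α γ N z ≤
      (∑' k, (dualSet N z).indicator (fun k => invWeight α γ k ^ 2) k) ^ (1 / 2 : ℝ) := by
  refine iSup₂_le fun f hf => (error_le hf.1 hN z).trans ?_
  have h := tsum_enorm_fourierCoefficient_mul_le hf ((dualSet N z).indicator 1)
  have h1 : ∀ k, ‖fourierCoefficient f k‖ₑ * (dualSet N z).indicator 1 k =
      (dualSet N z).indicator (fun k => ‖fourierCoefficient f k‖ₑ) k := by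
    intro k
    by_cases hk : k ∈ dualSet N z <;> simp [hk]
  have h2 : ∀ k, (invWeight α γ k * (dualSet N z).indicator 1 k) ^ 2 =
      (dualSet N z).indicator (fun k => invWeight α γ k ^ 2) k := by
    intro k
    by_cases hk : k ∈ dualSet N z <;> simp [hk]
  simpa only [h1, h2] using h

/-- The scaled cosine `c cos(2π k·x)`. -/
def cosine {d : ℕ} (c : ℝ) (k : Fin d → ℤ) (x : Fin d → ℝ) : ℝ := c * (trigMonomial k x).re

theorem cosine_eq {d : ℕ} (c : ℝ) (k : Fin d → ℤ) (x : Fin d → ℝ) :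
    (cosine c k x : ℂ) = c / 2 * trigMonomial k x + c / 2 * trigMonomial (-k) x := by
  rw [cosine, ← conj_trigMonomial, Complex.ofReal_mul, Complex.re_eq_add_conj]
  ring

theorem fourierCoefficient_cosine {d : ℕ} (c : ℝ) (k l : Fin d → ℤ) :
    fourierCoefficient (cosine c k) l =
      (if l = k then (c / 2 : ℂ) else 0) + (if l = -k then (c / 2 : ℂ) else 0) := by
  unfold fourierCoefficient
  have h : ∀ x, (cosine c k x : ℂ) * trigMonomial (-l) x =
      c / 2 * trigMonomial (k + -l) x + c / 2 * trigMonomial (-k + -l) x := by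
    intro x
    rw [cosine_eq, trigMonomial_add, trigMonomial_add]
    ring
  simp_rw [h]
  rw [MeasureTheory.integral_add ((integrableOn_trigMonomial _).const_mul _)
    ((integrableOn_trigMonomial _).const_mul _), MeasureTheory.integral_const_mul,
    MeasureTheory.integral_const_mul, integral_trigMonomial, integral_trigMonomial]
  have h1 : k + -l = 0 ↔ l = k := by rw [← sub_eq_add_neg, sub_eq_zero, eq_comm]
  have h2 : -k + -l = 0 ↔ l = -k := by rw [← sub_eq_add_neg, sub_eq_zero, eq_comm]
  simp only [h1, h2, mul_ite, mul_one, mul_zero]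

/-- The only coefficients are c/2 at k and -k. With c = 1/r each contributes (1/2)² to the squared
norm. -/
theorem cosine_mem_korobovBall {d : ℕ} {α : ℝ} {γ : ℕ → ℝ} {k : Fin d → ℤ} (hk : k ≠ 0)
    (hw : korobovWeight α γ k ≠ ∞) :
    cosine (korobovWeight α γ k)⁻¹.toReal k ∈ korobovBall d α γ := by
  set r := korobovWeight α γ k
  have hr : r ≠ 0 := korobovWeight_ne_zero α γ k
  set c := r⁻¹.toReal
  have hkk : k ≠ -k := by
    intro h
    apply hk
    ext j
    have := congrFun h j
    simp only [Pi.neg_apply, Pi.zero_apply] at *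
    omega
  have hF : ∀ l, fourierCoefficient (cosine c k) l =
      (if l = k then (c / 2 : ℂ) else 0) + (if l = -k then (c / 2 : ℂ) else 0) :=
    fourierCoefficient_cosine c k
  have hzero : ∀ l ∉ ({k, -k} : Finset (Fin d → ℤ)), fourierCoefficient (cosine c k) l = 0 := by
    intro l hl
    simp only [Finset.mem_insert, Finset.mem_singleton, not_or] at hl
    rw [hF, if_neg hl.1, if_neg hl.2, add_zero]
  have hc2 : ‖(c / 2 : ℂ)‖ₑ * r ≤ 1 / 2 := by
    have h1 : ‖(c / 2 : ℂ)‖ₑ = r⁻¹ / 2 := by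
      have : (c / 2 : ℂ) = ((c / 2 : ℝ) : ℂ) := by push_cast; rfl
      rw [this, ← ofReal_norm, Complex.norm_real, Real.norm_of_nonneg
        (by positivity), ENNReal.ofReal_div_of_pos (by norm_num),
        ENNReal.ofReal_toReal (by simpa using hr)]
      simp
    rw [h1, div_eq_mul_inv, mul_right_comm, ENNReal.inv_mul_cancel hr hw, one_mul, one_div]
  have hnorm : korobovNorm α γ (cosine c k) ≤ 1 := by
    unfold korobovNorm
    rw [ennreal_rpow_le_one_iff (by norm_num), tsum_eq_sum (s := {k, -k}) fun l hl => by
      simp [hzero l hl], Finset.sum_pair hkk, hF, hF, if_pos rfl, if_neg hkk, if_neg hkk.symm,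
      if_pos rfl, add_zero, zero_add, korobovWeight_neg]
    calc _ ≤ (1 / 2 : ℝ≥0∞) ^ 2 + (1 / 2) ^ 2 := by gcongr
      _ ≤ (1 / 2 : ℝ≥0∞) + 1 / 2 := by
        have : (1 / 2 : ℝ≥0∞) ^ 2 ≤ 1 / 2 := pow_le_of_le_one (by simp) (by simp) (by norm_num)
        gcongr
      _ = 1 := by rw [ENNReal.add_halves]
  refine ⟨⟨?_, ?_, ?_, hnorm.trans_lt ENNReal.one_lt_top⟩, hnorm⟩
  · intro x j
    unfold cosine
    congr 2
    unfold trigMonomial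
    rw [Complex.exp_eq_exp_iff_exists_int]
    refine ⟨k j, ?_⟩
    have : ∑ i, (k i : ℝ) * (x + Pi.single j 1 : Fin d → ℝ) i = ∑ i, (k i : ℝ) * x i + k j := by
      simp [mul_add, Finset.sum_add_distrib, Pi.single_apply]
    rw [this]
    push_cast
    ring
  · exact summable_of_ne_finset_zero (s := {k, -k}) fun l hl => by simp [hzero l hl]
  · intro x
    have h := hasSum_sum_of_ne_finset_zero (s := {k, -k})
      (L := SummationFilter.unconditional _)
      (f := fun l => fourierCoefficient (cosine c k) l * trigMonomial l x)
      fun l hl => by simp [hzero l hl]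
    rw [Finset.sum_pair hkk, hF, hF, if_pos rfl, if_neg hkk, if_neg hkk.symm,
      if_pos rfl, add_zero, zero_add, ← cosine_eq] at h
    exact h

/-- Every nonzero element of the dual lattice bounds the worst-case error from below. -/
theorem invWeight_le_worstCaseError {d : ℕ} {α : ℝ} {γ : ℕ → ℝ} {N : ℕ} (hN : 0 < N)
    {z : Fin d → ℕ} {k : Fin d → ℤ} (hk : k ∈ dualSet N z) :
    invWeight α γ k ≤ worstCaseError α γ N z := by
  by_cases hw : korobovWeight α γ k = ∞
  · simp [invWeight, hw]
  have hr : korobovWeight α γ k ≠ 0 := korobovWeight_ne_zero α γ k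
  have hmem := cosine_mem_korobovBall hk.1 hw
  refine le_trans (le_of_eq ?_) (le_iSup₂ _ hmem)
  set c := (korobovWeight α γ k)⁻¹.toReal
  have h0 : (0 : Fin d → ℤ) ≠ -k := fun h => hk.1 (by rw [← neg_neg k, ← h, neg_zero])
  have hI : cubeIntegral (cosine c k) = 0 := by
    have := cubeIntegral_eq (cosine c k)
    rw [fourierCoefficient_cosine, if_neg hk.1.symm, if_neg h0, add_zero] at this
    exact_mod_cast this
  have hQ : latticeRule N z (cosine c k) = c := by
    have hav := average_trigMonomial_lattice hN z k
    rw [if_pos hk.2] at hav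
    have hre := congrArg Complex.re hav
    unfold latticeRule cosine
    rw [← Finset.mul_sum, mul_left_comm]
    have h1 : (1 / (N : ℂ)) = ((1 / (N : ℝ) : ℝ) : ℂ) := by push_cast; rfl
    rw [h1, Complex.re_ofReal_mul, Complex.re_sum, Complex.one_re] at hre
    rw [hre, mul_one]
  rw [hI, hQ, zero_sub, abs_neg, abs_of_nonneg ENNReal.toReal_nonneg, ENNReal.ofReal_toReal]
  · rfl
  · simpa using hr

/-! ### Counting generating vectors and draws -/

/-- In a solution z of k·z ≡ 0 mod N the other coordinates determine z_j, because k_j is invertible.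
Overwriting z_j by an arbitrary t in {1, …, N-1} is therefore injective on pairs (z, t). -/
theorem card_candidates_dvd_mul_le {d N : ℕ} (hN : N.Prime) {k : Fin d → ℤ} {j : Fin d}
    (hj : ¬ (N : ℤ) ∣ k j) :
    ((candidates d N).filter fun z => (N : ℤ) ∣ ∑ i, k i * z i).card * (N - 1) ≤
      (candidates d N).card := by
  have hN' : (N - 1) = (Finset.Icc 1 (N - 1)).card := by simp
  conv_lhs => rw [hN']
  rw [← Finset.card_product]
  refine Finset.card_le_card_of_injOn (fun p => Function.update p.1 j p.2) ?_ ?_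
  · rintro ⟨z, t⟩ h
    simp only [Finset.coe_product, Finset.coe_filter, Set.mem_prod, Set.mem_ofPred_eq,
      Finset.mem_coe] at h
    simp only [candidates, Finset.mem_coe, Fintype.mem_piFinset] at h ⊢
    intro i
    by_cases hi : i = j
    · subst hi; simpa using h.2
    · simpa [hi] using h.1.1 i
  · rintro ⟨z, t⟩ h ⟨z', t'⟩ h' heq
    simp only [Finset.coe_product, Finset.coe_filter, Set.mem_prod, Set.mem_ofPred_eq,
      Finset.mem_coe] at h h'
    simp only [candidates, Fintype.mem_piFinset, Finset.mem_Icc] at h h'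
    have ht : t = t' := by simpa using congrFun heq j
    have hoff : ∀ i, i ≠ j → z i = z' i := fun i hi => by simpa [hi] using congrFun heq i
    have hdiff : (N : ℤ) ∣ k j * ((z j : ℤ) - z' j) := by
      have h1 := dvd_sub h.1.2 h'.1.2
      rw [← Finset.sum_sub_distrib, Finset.sum_eq_single j] at h1
      · rwa [← mul_sub] at h1
      · intro i _ hi
        rw [hoff i hi, sub_self]
      · simp
    have hd2 := ((Nat.prime_iff_prime_int.1 hN).dvd_or_dvd hdiff).resolve_left hj
    have hzj : z j = z' j := by
      have hb := h.1.1 j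
      have hb' := h'.1.1 j
      obtain ⟨q, hq⟩ := hd2
      have hq0 : q = 0 := by
        have hNpos : (0 : ℤ) < N := by exact_mod_cast hN.pos
        by_contra hne
        rcases lt_or_gt_of_ne hne with h0 | h0
        · have : (N : ℤ) * q ≤ N * (-1) := mul_le_mul_of_nonneg_left (by omega) hNpos.le
          omega
        · have : (N : ℤ) * 1 ≤ N * q := mul_le_mul_of_nonneg_left (by omega) hNpos.le
          omega
      rw [hq0, mul_zero] at hq
      omega
    have hz : z = z' := by
      ext i
      by_cases hi : i = j
      · rw [hi, hzj]
      · exact hoff i hi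
    rw [hz, ht]

/-- Each single draw has the uniform marginal law, written without division. -/
theorem card_piFinset_filter_apply {V : Type*} [DecidableEq V] {r : ℕ} (A : Finset V)
    (p : V → Prop) [DecidablePred p] (i : Fin r) :
    ((Fintype.piFinset fun _ : Fin r => A).filter fun z => p (z i)).card * A.card =
      (A.filter p).card * (Fintype.piFinset fun _ : Fin r => A).card := by
  have h : ((Fintype.piFinset fun _ : Fin r => A).filter fun z => p (z i)) =
      Fintype.piFinset (Function.update (fun _ : Fin r => A) i (A.filter p)) := by
    ext z
    simp only [Finset.mem_filter, Fintype.mem_piFinset]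
    constructor
    · rintro ⟨h1, h2⟩ j
      by_cases hj : j = i
      · subst hj; simp [h1 j, h2]
      · simp [hj, h1 j]
    · intro h1
      have hi : z i ∈ A.filter p := by simpa using h1 i
      refine ⟨fun j => ?_, (Finset.mem_filter.1 hi).2⟩
      by_cases hj : j = i
      · subst hj; exact (Finset.mem_filter.1 hi).1
      · simpa [hj] using h1 j
  rw [h, Fintype.card_piFinset, Fintype.card_piFinset,
    ← Finset.mul_prod_erase _ _ (Finset.mem_univ i),
    ← Finset.mul_prod_erase _ (fun _ => A.card) (Finset.mem_univ i)]
  have h2 : ∏ x ∈ Finset.univ.erase i,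
      (Function.update (fun _ : Fin r => A) i (A.filter p) x).card =
      ∏ x ∈ Finset.univ.erase i, A.card := by
    refine Finset.prod_congr rfl fun j hj => ?_
    rw [Function.update_of_ne (Finset.ne_of_mem_erase hj)]
  rw [h2, Function.update_self]
  ring

/-- Independence of the draws; it produces the factor (1-η)^r. -/
theorem card_draws_forall {d r N : ℕ} (p : (Fin d → ℕ) → Prop) [DecidablePred p] :
    ((draws d r N).filter fun z => ∀ i, p (z i)).card = ((candidates d N).filter p).card ^ r := by
  have h : ((draws d r N).filter fun z => ∀ i, p (z i)) =
      Fintype.piFinset fun _ : Fin r => (candidates d N).filter p := by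
    ext z
    simp only [draws, Finset.mem_filter, Fintype.mem_piFinset, forall_and]
  rw [h, Fintype.card_piFinset]
  simp

theorem candidates_card_pos {d N : ℕ} (hN : 2 ≤ N) : 0 < (candidates d N).card := by
  simp only [candidates, Fintype.card_piFinset, Nat.card_Icc]
  exact Finset.prod_pos fun _ _ => by omega

theorem card_draws (d r N : ℕ) : (draws d r N).card = (candidates d N).card ^ r := by
  simp [draws, Fintype.card_piFinset]

/-- A union bound over the draws. It covers the selected vector although the selection depends on
all of them. -/
theorem card_draws_exists_mul_le {d r N : ℕ} (hN : N.Prime) {k : Fin d → ℤ} {j : Fin d}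
    (hj : ¬ (N : ℤ) ∣ k j) :
    ((draws d r N).filter fun z => ∃ i, (N : ℤ) ∣ ∑ l, k l * z i l).card * (N - 1) ≤
      r * (draws d r N).card := by
  have hA := candidates_card_pos (d := d) hN.two_le
  have h1 : ∀ i : Fin r, ((draws d r N).filter fun z => (N : ℤ) ∣ ∑ l, k l * z i l).card *
      (N - 1) ≤ (draws d r N).card := by
    intro i
    have h := card_piFinset_filter_apply (candidates d N)
      (fun v => (N : ℤ) ∣ ∑ l, k l * v l) i
    have h2 := card_candidates_dvd_mul_le hN hj
    refine Nat.le_of_mul_le_mul_right ?_ hA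
    calc _ = ((draws d r N).filter fun z => (N : ℤ) ∣ ∑ l, k l * z i l).card *
          (candidates d N).card * (N - 1) := by ring
      _ = ((candidates d N).filter fun z => (N : ℤ) ∣ ∑ i, k i * z i).card * (N - 1) *
          (draws d r N).card := by
            rw [draws, h]
            ring
      _ ≤ (candidates d N).card * (draws d r N).card := by gcongr
      _ = _ := mul_comm _ _
  have h2 : ((draws d r N).filter fun z => ∃ i, (N : ℤ) ∣ ∑ l, k l * z i l) ⊆
      Finset.univ.biUnion fun i : Fin r =>
        (draws d r N).filter fun z => (N : ℤ) ∣ ∑ l, k l * z i l := by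
    intro z hz
    obtain ⟨hz, i, hi⟩ := Finset.mem_filter.1 hz
    exact Finset.mem_biUnion.2 ⟨i, Finset.mem_univ i, Finset.mem_filter.2 ⟨hz, hi⟩⟩
  calc _ ≤ (∑ i : Fin r, ((draws d r N).filter fun z => (N : ℤ) ∣ ∑ l, k l * z i l).card) *
        (N - 1) := by
        gcongr
        exact (Finset.card_le_card h2).trans Finset.card_biUnion_le
    _ = ∑ i : Fin r, ((draws d r N).filter fun z => (N : ℤ) ∣ ∑ l, k l * z i l).card *
        (N - 1) := Finset.sum_mul _ _ _
    _ ≤ ∑ _i : Fin r, (draws d r N).card := Finset.sum_le_sum fun i _ => h1 i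
    _ = _ := by simp

/-! ### Averaging over generating vectors -/

/-- Monotonicity of `ℓ^s` norms: `‖a‖_2 ≤ ‖a‖_s` for `0 < s ≤ 2`. -/
theorem ennreal_tsum_sq_rpow_le {ι : Type*} (a : ι → ℝ≥0∞) {s : ℝ} (hs : 0 < s) (hs2 : s ≤ 2) :
    (∑' i, a i ^ 2) ^ (s / 2) ≤ ∑' i, a i ^ s := by
  set A := ∑' i, a i ^ s
  have h1 : ∀ i, a i ^ 2 ≤ A ^ ((2 - s) / s) * a i ^ s := by
    intro i
    have h2 : a i ≤ A ^ (1 / s) := by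
      rw [one_div, ENNReal.le_rpow_inv_iff hs]
      exact ENNReal.le_tsum i
    calc a i ^ 2 = a i ^ (2 - s) * a i ^ s := by
          rw [← ENNReal.rpow_add_of_nonneg _ _ (by linarith) hs.le, ← ENNReal.rpow_two]
          ring_nf
      _ ≤ (A ^ (1 / s)) ^ (2 - s) * a i ^ s := by
          gcongr
      _ = _ := by
          rw [← ENNReal.rpow_mul]
          ring_nf
  have h3 : ∑' i, a i ^ 2 ≤ A ^ (2 / s) := by
    calc ∑' i, a i ^ 2 ≤ A ^ ((2 - s) / s) * A := by
          rw [← ENNReal.tsum_mul_left]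
          exact ENNReal.tsum_le_tsum h1
      _ = A ^ ((2 - s) / s) * A ^ (1 : ℝ) := by rw [ENNReal.rpow_one]
      _ = A ^ (2 / s) := by
          rw [← ENNReal.rpow_add_of_nonneg _ _ (div_nonneg (by linarith) hs.le) zero_le_one]
          congr 1
          field_simp
          ring
  calc _ ≤ (A ^ (2 / s)) ^ (s / 2) := by gcongr
    _ = A := by
      rw [← ENNReal.rpow_mul]
      have : 2 / s * (s / 2) = 1 := by field_simp
      rw [this, ENNReal.rpow_one]

/-- Averaging the power s = 1/λ instead of the square is what lets Markov's inequality give the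
order N^(-λ) instead of N^(-1/2). -/
theorem worstCaseError_rpow_le {d : ℕ} (α : ℝ) (γ : ℕ → ℝ) {N : ℕ} (hN : 0 < N)
    (z : Fin d → ℕ) {s : ℝ} (hs : 0 < s) (hs2 : s ≤ 2) :
    worstCaseError α γ N z ^ s ≤
      ∑' k, (dualSet N z).indicator (fun k => invWeight α γ k ^ s) k := by
  have h1 := worstCaseError_le α γ hN z
  have h2 := ennreal_tsum_sq_rpow_le ((dualSet N z).indicator (invWeight α γ)) hs hs2
  have e1 : ∀ k, (dualSet N z).indicator (invWeight α γ) k ^ s =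
      (dualSet N z).indicator (fun k => invWeight α γ k ^ s) k := by
    intro k
    by_cases hk : k ∈ dualSet N z <;> simp [hk, hs]
  have e2 : ∀ k, (dualSet N z).indicator (invWeight α γ) k ^ 2 =
      (dualSet N z).indicator (fun k => invWeight α γ k ^ 2) k := by
    intro k
    by_cases hk : k ∈ dualSet N z <;> simp [hk]
  simp only [e1, e2] at h2
  calc _ ≤ ((∑' k, (dualSet N z).indicator (fun k => invWeight α γ k ^ 2) k) ^ (1 / 2 : ℝ)) ^ s := by
        gcongr
    _ ≤ _ := by
        rw [← ENNReal.rpow_mul]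
        convert h2 using 2
        ring

/-- The average over all generating vectors of the dual lattice sums. -/
theorem sum_candidates_dualSet_le {d : ℕ} {α : ℝ} (hα : 0 < α) (γ : ℕ → ℝ) {N : ℕ}
    (hN : N.Prime) {s : ℝ} (hs : 0 < s) (hαs : 1 ≤ α * s) :
    ((N - 1 : ℕ) : ℝ≥0∞) * ∑ z ∈ candidates d N,
      ∑' k, (dualSet N z).indicator (fun k => invWeight α γ k ^ s) k ≤
      2 * (candidates d N).card * invWeightSum d α γ s := by
  classical
  set c : ℝ≥0∞ := ((candidates d N).card : ℝ≥0∞)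
  have hN1 : (1 : ℝ) ≤ N := by exact_mod_cast hN.one_lt.le
  set Q := {k : Fin d → ℤ | k ≠ 0 ∧ ∀ j, (N : ℤ) ∣ k j}
  -- A k not divisible by N is dual to at most a fraction 1/(N-1) of the vectors. A multiple of N
  -- may be dual to all of them, and the decay N^(-αs) ≤ 1/N in `hfac` pays for this.
  have key : ∀ k : Fin d → ℤ, ((N - 1 : ℕ) : ℝ≥0∞) * ∑ z ∈ candidates d N,
      (dualSet N z).indicator (fun k => invWeight α γ k ^ s) k ≤
      c * invWeight α γ k ^ s +
        (N - 1 : ℕ) * c * Q.indicator (fun k => invWeight α γ k ^ s) k := by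
    intro k
    by_cases hk : k = 0
    · subst hk
      simp [dualSet]
    by_cases hd : ∀ j, (N : ℤ) ∣ k j
    · rw [Set.indicator_of_mem (show k ∈ Q from ⟨hk, hd⟩), mul_assoc]
      refine le_add_left (mul_le_mul_right ?_ _)
      calc _ ≤ ∑ z ∈ candidates d N, invWeight α γ k ^ s :=
            Finset.sum_le_sum fun z _ =>
              Set.indicator_le_self' (f := fun k => invWeight α γ k ^ s) (fun _ _ => zero_le) k
        _ = c * invWeight α γ k ^ s := by simp [c]
    · push Not at hd
      obtain ⟨j, hj⟩ := hd
      refine le_add_right ?_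
      have h1 : ∑ z ∈ candidates d N,
          (dualSet N z).indicator (fun k => invWeight α γ k ^ s) k =
          ((candidates d N).filter fun z => (N : ℤ) ∣ ∑ i, k i * z i).card *
            invWeight α γ k ^ s := by
        rw [← nsmul_eq_mul, ← Finset.sum_const, Finset.sum_filter]
        refine Finset.sum_congr rfl fun z _ => ?_
        simp [Set.indicator_apply, dualSet, hk]
      rw [h1, ← mul_assoc]
      gcongr
      rw [mul_comm]
      simp only [c]
      exact_mod_cast card_candidates_dvd_mul_le hN hj
  have hmul := tsum_invWeight_multiples_le (d := d) hα (γ := γ) hN.pos hs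
  have hfac : ((N - 1 : ℕ) : ℝ≥0∞) * ENNReal.ofReal ((N : ℝ) ^ (-(α * s))) ≤ 1 := by
    have hNle : ((N - 1 : ℕ) : ℝ) ≤ N := by exact_mod_cast Nat.sub_le _ _
    rw [← ENNReal.ofReal_natCast, ← ENNReal.ofReal_mul (by positivity), ENNReal.ofReal_le_one]
    calc _ ≤ (N : ℝ) * (N : ℝ) ^ (-1 : ℝ) := by
          gcongr
      _ = 1 := by rw [Real.rpow_neg_one]; exact mul_inv_cancel₀ (by linarith)
  rw [← Summable.tsum_finsetSum fun _ _ => ENNReal.summable, ← ENNReal.tsum_mul_left]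
  calc _ ≤ ∑' k, (c * invWeight α γ k ^ s +
        (N - 1 : ℕ) * c * Q.indicator (fun k => invWeight α γ k ^ s) k) :=
        ENNReal.tsum_le_tsum key
    _ = c * invWeightSum d α γ s + (N - 1 : ℕ) * c *
        ∑' k, Q.indicator (fun k => invWeight α γ k ^ s) k := by
        rw [ENNReal.tsum_add, ENNReal.tsum_mul_left, ENNReal.tsum_mul_left]
        rfl
    _ ≤ c * invWeightSum d α γ s + (N - 1 : ℕ) * c *
        (ENNReal.ofReal ((N : ℝ) ^ (-(α * s))) * invWeightSum d α γ s) := by gcongr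
    _ = c * invWeightSum d α γ s + ((N - 1 : ℕ) *
        ENNReal.ofReal ((N : ℝ) ^ (-(α * s)))) * (c * invWeightSum d α γ s) := by ring
    _ ≤ c * invWeightSum d α γ s + 1 * (c * invWeightSum d α γ s) := by gcongr
    _ = _ := by ring

open Classical in
/-- Markov's inequality for the worst-case error of a random generating vector. -/
theorem card_bad_candidates_le {d : ℕ} {α : ℝ} (hα : 0 < α) (γ : ℕ → ℝ) {N : ℕ}
    (hN : N.Prime) {lam : ℝ} (hlam : 1 / 2 ≤ lam) (hlamα : lam ≤ α) {β T : ℝ≥0∞}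
    (hT0 : T ≠ 0) (hTt : T ≠ ∞)
    (hT : 2 * invWeightSum d α γ (1 / lam) ≤ β * T * (N - 1 : ℕ)) :
    (((candidates d N).filter fun z => T ^ lam < worstCaseError α γ N z).card : ℝ≥0∞) ≤
      β * (candidates d N).card := by
  have hl0 : 0 < lam := by linarith
  set s := 1 / lam
  have hs : 0 < s := by positivity
  have hs2 : s ≤ 2 := by
    rw [div_le_iff₀ hl0]; linarith
  have hαs : 1 ≤ α * s := by
    rw [mul_one_div, le_div_iff₀ hl0]; linarith
  have h1 := sum_candidates_dualSet_le (d := d) hα γ hN hs hαs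
  set bad := (candidates d N).filter fun z => T ^ lam < worstCaseError α γ N z
  have h2 : (bad.card : ℝ≥0∞) * T ≤ ∑ z ∈ candidates d N,
      ∑' k, (dualSet N z).indicator (fun k => invWeight α γ k ^ s) k := by
    calc (bad.card : ℝ≥0∞) * T = ∑ z ∈ bad, T := by simp
      _ ≤ ∑ z ∈ bad, ∑' k, (dualSet N z).indicator (fun k => invWeight α γ k ^ s) k := by
          refine Finset.sum_le_sum fun z hz => ?_
          refine le_trans ?_ (worstCaseError_rpow_le α γ hN.pos z hs hs2)
          have h3 := (Finset.mem_filter.1 hz).2.le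
          calc T = (T ^ lam) ^ s := by
                rw [← ENNReal.rpow_mul, mul_one_div_cancel hl0.ne', ENNReal.rpow_one]
            _ ≤ _ := by gcongr
      _ ≤ _ := Finset.sum_le_sum_of_subset (Finset.filter_subset _ _)
  have hN0 : ((N - 1 : ℕ) : ℝ≥0∞) ≠ 0 := by
    have := hN.two_le
    exact_mod_cast (by omega : N - 1 ≠ 0)
  have hm0 : T * (N - 1 : ℕ) ≠ 0 := mul_ne_zero hT0 hN0
  have hmt : T * (N - 1 : ℕ) ≠ ∞ := ENNReal.mul_ne_top hTt (ENNReal.natCast_ne_top _)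
  rw [← ENNReal.mul_le_mul_iff_left hm0 hmt]
  calc (bad.card : ℝ≥0∞) * (T * (N - 1 : ℕ)) = (N - 1 : ℕ) * ((bad.card : ℝ≥0∞) * T) := by ring
    _ ≤ _ := by gcongr
    _ ≤ _ := h1
    _ = (candidates d N).card * (2 * invWeightSum d α γ s) := by ring
    _ ≤ (candidates d N).card * (β * T * (N - 1 : ℕ)) := by gcongr
    _ = _ := by ring

/-! ### The expected error for a fixed number of points -/

/-- The nonzero frequencies all of whose entries are multiples of `N`. -/
def multiples (d N : ℕ) : Set (Fin d → ℤ) := {k | k ≠ 0 ∧ ∀ j, (N : ℤ) ∣ k j}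

/-- The crude error bound used on the rare event that all draws are bad. -/
theorem tsum_enorm_fourierCoefficient_le {d : ℕ} {α : ℝ} {γ : ℕ → ℝ}
    {f : (Fin d → ℝ) → ℝ} (hf : f ∈ korobovBall d α γ) :
    ∑' k, ‖fourierCoefficient f k‖ₑ ≤ invWeightSum d α γ 2 ^ (1 / 2 : ℝ) := by
  have h := tsum_enorm_fourierCoefficient_mul_le hf 1
  simpa [invWeightSum] using h

/-- Cauchy–Schwarz, splitting ρ² = ρ^(2-1/λ) ρ^(1/λ): on `G` the first factor is at most T^(2λ-1),
and the second is summable. -/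
theorem tsum_enorm_fourierCoefficient_small_le {d : ℕ} {α : ℝ} {γ : ℕ → ℝ}
    {f : (Fin d → ℝ) → ℝ} (hf : f ∈ korobovBall d α γ) {lam : ℝ} (hlam : 1 / 2 < lam)
    (T : ℝ≥0∞) (G : Set (Fin d → ℤ)) (hG : ∀ k ∈ G, invWeight α γ k ≤ T ^ lam) :
    ∑' k, G.indicator (fun k => ‖fourierCoefficient f k‖ₑ) k ≤
      (T ^ (2 * lam - 1) * invWeightSum d α γ (1 / lam)) ^ (1 / 2 : ℝ) := by
  have hl0 : 0 < lam := by linarith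
  have h := tsum_enorm_fourierCoefficient_mul_le hf (G.indicator 1)
  have h1 : ∀ k, ‖fourierCoefficient f k‖ₑ * G.indicator 1 k =
      G.indicator (fun k => ‖fourierCoefficient f k‖ₑ) k := by
    intro k
    by_cases hk : k ∈ G <;> simp [hk]
  simp only [h1] at h
  refine h.trans (ENNReal.rpow_le_rpow ?_ (by norm_num))
  rw [invWeightSum, ← ENNReal.tsum_mul_left]
  refine ENNReal.tsum_le_tsum fun k => ?_
  by_cases hk : k ∈ G
  · have h2 : (0 : ℝ) ≤ 2 - 1 / lam := by
      rw [sub_nonneg, div_le_iff₀ hl0]; linarith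
    have h3 : invWeight α γ k ^ 2 =
        invWeight α γ k ^ (2 - 1 / lam) * invWeight α γ k ^ (1 / lam) := by
      rw [← ENNReal.rpow_add_of_nonneg _ _ h2 (by positivity), ← ENNReal.rpow_two]
      ring_nf
    rw [Set.indicator_of_mem hk, Pi.one_apply, mul_one, h3]
    gcongr
    calc invWeight α γ k ^ (2 - 1 / lam) ≤ (T ^ lam) ^ (2 - 1 / lam) := by
          gcongr
          exact hG k hk
      _ = T ^ (2 * lam - 1) := by
          rw [← ENNReal.rpow_mul]
          congr 1
          field_simp
  · simp [hk]

open Classical in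
/-- The expected error for a fixed number of points `N`. -/
theorem sum_draws_error_le {d r : ℕ} {α : ℝ} (hα : 0 < α) {γ : ℕ → ℝ}
    {f : (Fin d → ℝ) → ℝ} (hf : f ∈ korobovBall d α γ) {N : ℕ}
    (hN : N.Prime) {lam : ℝ} (hlam : 1 / 2 < lam) (hlamα : lam ≤ α) {β T : ℝ≥0∞}
    (hT0 : T ≠ 0) (hTt : T ≠ ∞)
    (hT : 2 * invWeightSum d α γ (1 / lam) ≤ β * T * (N - 1 : ℕ))
    (sel : (Fin r → Fin d → ℕ) → Fin r)
    (hsel : ∀ z ∈ draws d r N, ∀ j,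
      worstCaseError α γ N (z (sel z)) ≤ worstCaseError α γ N (z j)) :
    ∑ z ∈ draws d r N, ENNReal.ofReal |cubeIntegral f - latticeRule N (z (sel z)) f| ≤
      (draws d r N).card * (β ^ r * invWeightSum d α γ 2 ^ (1 / 2 : ℝ) +
        r / (N - 1 : ℕ) * (T ^ (2 * lam - 1) * invWeightSum d α γ (1 / lam)) ^ (1 / 2 : ℝ) +
        ∑' k, (multiples d N).indicator (fun k => ‖fourierCoefficient f k‖ₑ) k) := by
  set c : (Fin d → ℤ) → ℝ≥0∞ := fun k => ‖fourierCoefficient f k‖ₑ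
  set G : Set (Fin d → ℤ) := {k | invWeight α γ k ≤ T ^ lam ∧ ∃ j, ¬ (N : ℤ) ∣ k j}
  set E := ∑' k, (multiples d N).indicator c k
  set S := invWeightSum d α γ 2 ^ (1 / 2 : ℝ)
  let bad : (Fin r → Fin d → ℕ) → Prop := fun z => ∀ i, T ^ lam < worstCaseError α γ N (z i)
  let hit : (Fin d → ℤ) → (Fin r → Fin d → ℕ) → Prop := fun k z =>
    ∃ i, (N : ℤ) ∣ ∑ l, k l * z i l
  -- If some draw is good, so is the minimizer; then each of its dual frequencies is either a
  -- multiple of N or lies in `G` and is hit by a draw. Unlike `sel z`, the set `G` does not depend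
  -- on z, so expectations can be taken termwise.
  have hpt : ∀ z ∈ draws d r N,
      ENNReal.ofReal |cubeIntegral f - latticeRule N (z (sel z)) f| ≤
      (if bad z then S else 0) + ∑' k, G.indicator c k * (if hit k z then 1 else 0) + E := by
    intro z hz
    by_cases hb : bad z
    · rw [if_pos hb, add_assoc]
      refine le_add_right (((error_le hf.1 hN.pos _).trans ?_).trans
        (tsum_enorm_fourierCoefficient_le hf))
      exact ENNReal.tsum_le_tsum fun k => Set.indicator_le_self' (f := c) (fun _ _ => zero_le) k
    · rw [if_neg hb, zero_add]
      have hgood : worstCaseError α γ N (z (sel z)) ≤ T ^ lam := by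
        simp only [bad, not_forall, not_lt] at hb
        obtain ⟨i, hi⟩ := hb
        exact (hsel z hz i).trans hi
      refine (error_le hf.1 hN.pos _).trans ?_
      rw [← ENNReal.tsum_add]
      refine ENNReal.tsum_le_tsum fun k => ?_
      by_cases hk : k ∈ dualSet N (z (sel z))
      · rw [Set.indicator_of_mem hk]
        by_cases hm : ∀ j, (N : ℤ) ∣ k j
        · rw [Set.indicator_of_mem (show k ∈ multiples d N from ⟨hk.1, hm⟩)]
          exact le_add_left le_rfl
        · push Not at hm
          have hkG : k ∈ G := ⟨(invWeight_le_worstCaseError hN.pos hk).trans hgood, hm⟩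
          have hkh : hit k z := ⟨sel z, hk.2⟩
          rw [Set.indicator_of_mem hkG, if_pos hkh, mul_one]
          exact le_add_right le_rfl
      · rw [Set.indicator_of_notMem hk]
        exact zero_le
  have hbad : (((draws d r N).filter bad).card : ℝ≥0∞) ≤ (draws d r N).card * β ^ r := by
    have h1 := card_bad_candidates_le (d := d) hα γ hN hlam.le hlamα hT0 hTt hT
    have h2 := card_draws_forall (d := d) (r := r) (N := N)
      fun z => T ^ lam < worstCaseError α γ N z
    simp only [bad]
    rw [h2, card_draws]
    push_cast
    rw [mul_comm, ← mul_pow]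
    gcongr
  have hN0 : ((N - 1 : ℕ) : ℝ≥0∞) ≠ 0 := by
    have := hN.two_le
    exact_mod_cast (by omega : N - 1 ≠ 0)
  have hhit : ∀ k, G.indicator c k * ((draws d r N).filter (hit k)).card ≤
      (draws d r N).card * (r / (N - 1 : ℕ)) * G.indicator c k := by
    intro k
    by_cases hk : k ∈ G
    · rw [mul_comm]
      gcongr
      rw [← mul_div_assoc, ENNReal.le_div_iff_mul_le (Or.inl hN0)
        (Or.inl (ENNReal.natCast_ne_top _)), mul_comm ((draws d r N).card : ℝ≥0∞)]
      obtain ⟨j, hj⟩ := hk.2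
      exact_mod_cast card_draws_exists_mul_le (r := r) hN hj
    · simp [hk]
  calc _ ≤ ∑ z ∈ draws d r N, ((if bad z then S else 0) +
        ∑' k, G.indicator c k * (if hit k z then 1 else 0) + E) := Finset.sum_le_sum hpt
    _ = ((draws d r N).filter bad).card * S +
        ∑' k, G.indicator c k * ((draws d r N).filter (hit k)).card +
        (draws d r N).card * E := by
        rw [Finset.sum_add_distrib, Finset.sum_add_distrib, ← Finset.sum_filter,
          Finset.sum_const, Finset.sum_const, nsmul_eq_mul, nsmul_eq_mul,
          ← Summable.tsum_finsetSum fun _ _ => ENNReal.summable]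
        congr 2
        refine tsum_congr fun k => ?_
        rw [← Finset.mul_sum, Finset.sum_boole]
    _ ≤ (draws d r N).card * β ^ r * S +
        (draws d r N).card * (r / (N - 1 : ℕ)) * ∑' k, G.indicator c k +
        (draws d r N).card * E := by
        exact add_le_add (add_le_add (mul_le_mul' hbad le_rfl)
          ((ENNReal.tsum_le_tsum hhit).trans_eq ENNReal.tsum_mul_left)) le_rfl
    _ ≤ (draws d r N).card * β ^ r * S +
        (draws d r N).card * (r / (N - 1 : ℕ)) *
          (T ^ (2 * lam - 1) * invWeightSum d α γ (1 / lam)) ^ (1 / 2 : ℝ) +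
        (draws d r N).card * E := by
        gcongr
        exact tsum_enorm_fourierCoefficient_small_le hf hlam T G fun k hk => hk.1
    _ = _ := by ring

/-! ### Frequencies divisible by N, averaged over the primes -/

/-- A nonzero frequency that is divisible by `m` primes has a small reciprocal weight. -/
theorem invWeight_le_of_primes_dvd {d : ℕ} {α : ℝ} (hα : 0 < α) {γ : ℕ → ℝ}
    (hγ1 : ∀ j, γ j ≤ 1) {k : Fin d → ℤ} (hk : k ≠ 0) (P : Finset ℕ)
    (hP : ∀ p ∈ P, p.Prime) (hd : ∀ p ∈ P, ∀ j, (p : ℤ) ∣ k j) :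
    invWeight α γ k ≤ ENNReal.ofReal ((2 : ℝ) ^ (-(α * P.card))) := by
  obtain ⟨j, hj⟩ := Function.ne_iff.1 hk
  have hj' : k j ≠ 0 := hj
  refine (invWeight_le_of_ne_zero hα hγ1 k j hj').trans (ENNReal.ofReal_le_ofReal ?_)
  have h1 : ∏ p ∈ P, p ∣ (k j).natAbs :=
    Finset.prod_primes_dvd _ (fun p hp => (hP p hp).prime) fun p hp =>
      Int.natCast_dvd.1 (hd p hp j)
  have h2 : 2 ^ P.card ≤ (k j).natAbs := by
    refine le_trans ?_ (Nat.le_of_dvd (Int.natAbs_pos.2 hj') h1)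
    exact Finset.pow_card_le_prod _ _ _ fun p hp => (hP p hp).two_le
  have h3 : (2 : ℝ) ^ P.card ≤ |(k j : ℝ)| := by
    rw [← Int.cast_abs, Int.abs_eq_natAbs]
    exact_mod_cast h2
  calc |(k j : ℝ)| ^ (-α) ≤ ((2 : ℝ) ^ P.card) ^ (-α) :=
        Real.rpow_le_rpow_of_nonpos (by positivity) h3 (by linarith)
    _ = _ := by
        rw [← Real.rpow_natCast, ← Real.rpow_mul (by norm_num)]
        ring_nf

/-- From exp t ≥ 1 + t; applied with m the number of sampled primes dividing a frequency. -/
theorem exists_nat_mul_rpow_le {x : ℝ} (hx : 0 < x) :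
    ∃ C : ℝ, 0 < C ∧ ∀ m : ℕ, (m : ℝ) * (2 : ℝ) ^ (-(x * m)) ≤ C := by
  have hl : 0 < Real.log 2 := Real.log_pos (by norm_num)
  refine ⟨1 / (x * Real.log 2), by positivity, fun m => ?_⟩
  rw [Real.rpow_neg (by norm_num), ← div_eq_mul_inv, div_le_div_iff₀ (by positivity)
    (by positivity), Real.rpow_def_of_pos (by norm_num)]
  have := Real.add_one_le_exp (Real.log 2 * (x * m))
  nlinarith

open Classical in
/-- The contribution of the frequencies that are multiples of the number of points. -/
theorem sum_multiples_le {d : ℕ} {α : ℝ} (hα : 0 < α) {γ : ℕ → ℝ} (hγ1 : ∀ j, γ j ≤ 1)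
    {f : (Fin d → ℝ) → ℝ} (hf : f ∈ korobovBall d α γ) {lam : ℝ} (hlam : 0 < lam)
    (hlamα : lam < α) {C : ℝ}
    (hC : ∀ m : ℕ, (m : ℝ) * (2 : ℝ) ^ (-(α * (2 - 2 * lam / α) * m)) ≤ C)
    (P : Finset ℕ) (hP : ∀ p ∈ P, p.Prime) {L : ℝ} (hL : 0 < L) (hPL : ∀ p ∈ P, L ≤ p) :
    ∑ N ∈ P, ∑' k, (multiples d N).indicator (fun k => ‖fourierCoefficient f k‖ₑ) k ≤
      (ENNReal.ofReal C * (P.card * (ENNReal.ofReal (L ^ (-(2 * lam))) *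
        invWeightSum d α γ (2 * lam / α)))) ^ (1 / 2 : ℝ) := by
  -- Chosen so that αs = 2λ, which gives decay N^(-2λ) over the multiples of N, while s < 2 leaves a
  -- positive power of ρ to spare.
  set s := 2 * lam / α
  have hs : 0 < s := by positivity
  have hτ : 0 < 2 - s := by
    rw [sub_pos, div_lt_iff₀ hα]; linarith
  have hαs : α * s = 2 * lam := by simp only [s]; field_simp
  let m : (Fin d → ℤ) → ℕ := fun k => (P.filter fun N => k ∈ multiples d N).card
  have hm : ∀ (g : (Fin d → ℤ) → ℝ≥0∞) (k : Fin d → ℤ),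
      ∑ N ∈ P, (multiples d N).indicator g k = g k * m k := by
    intro g k
    simp only [Set.indicator_apply]
    rw [← Finset.sum_filter, Finset.sum_const, nsmul_eq_mul, mul_comm]
  -- Since ρ(k) ≤ 2^(-α m(k)), the spare power ρ^(2-s) absorbs one factor m(k). The other one turns
  -- the sum over k back into a sum over the primes.
  have hkey : ∀ k, (invWeight α γ k * m k) ^ 2 ≤
      ENNReal.ofReal C * (invWeight α γ k ^ s * m k) := by
    intro k
    by_cases hk : k = 0
    · have : m k = 0 := by simp [m, hk, multiples]
      simp [this]
    have hw : invWeight α γ k ≤ ENNReal.ofReal ((2 : ℝ) ^ (-(α * m k))) := by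
      refine invWeight_le_of_primes_dvd hα hγ1 hk (P.filter fun N => k ∈ multiples d N)
        (fun p hp => hP p (Finset.mem_filter.1 hp).1) fun p hp => (Finset.mem_filter.1 hp).2.2
    have h1 : invWeight α γ k ^ (2 - s) * m k ≤ ENNReal.ofReal C := by
      calc _ ≤ ENNReal.ofReal ((2 : ℝ) ^ (-(α * m k))) ^ (2 - s) * m k := by gcongr
        _ = ENNReal.ofReal ((m k : ℝ) * (2 : ℝ) ^ (-(α * (2 - s) * m k))) := by
            rw [ENNReal.ofReal_rpow_of_nonneg (by positivity) hτ.le,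
              ← Real.rpow_mul (by norm_num), mul_comm, ← ENNReal.ofReal_natCast,
              ← ENNReal.ofReal_mul (by positivity)]
            congr 3
            ring
        _ ≤ _ := ENNReal.ofReal_le_ofReal (hC _)
    calc (invWeight α γ k * m k) ^ 2
        = (invWeight α γ k ^ (2 - s) * invWeight α γ k ^ s) * (m k) ^ 2 := by
          rw [← ENNReal.rpow_add_of_nonneg _ _ hτ.le hs.le, mul_pow, ← ENNReal.rpow_two]
          ring_nf
      _ = (invWeight α γ k ^ (2 - s) * m k) * (invWeight α γ k ^ s * m k) := by ring
      _ ≤ _ := by gcongr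
  rw [← Summable.tsum_finsetSum fun _ _ => ENNReal.summable]
  simp only [hm]
  refine (tsum_enorm_fourierCoefficient_mul_le hf fun k => (m k : ℝ≥0∞)).trans
    (ENNReal.rpow_le_rpow ?_ (by norm_num))
  calc _ ≤ ∑' k, ENNReal.ofReal C * (invWeight α γ k ^ s * m k) := ENNReal.tsum_le_tsum hkey
    _ = ENNReal.ofReal C * ∑ N ∈ P,
        ∑' k, (multiples d N).indicator (fun k => invWeight α γ k ^ s) k := by
        rw [ENNReal.tsum_mul_left, ← Summable.tsum_finsetSum fun _ _ => ENNReal.summable]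
        simp only [hm]
    _ ≤ ENNReal.ofReal C * ∑ N ∈ P,
        ENNReal.ofReal (L ^ (-(2 * lam))) * invWeightSum d α γ s := by
        gcongr with N hN
        refine (tsum_invWeight_multiples_le hα (hP N hN).pos hs).trans ?_
        rw [hαs]
        exact mul_le_mul_left (ENNReal.ofReal_le_ofReal
          (Real.rpow_le_rpow_of_nonpos hL (hPL N hN) (by linarith))) _
    _ = _ := by rw [Finset.sum_const, nsmul_eq_mul]

/-! ### Assembling the rates -/

theorem ofReal_expect_le {ι : Type*} {s : Finset ι} {g : ι → ℝ} (hg : ∀ i, 0 ≤ g i)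
    {B : ℝ≥0∞} (h : ∑ i ∈ s, ENNReal.ofReal (g i) ≤ s.card * B) :
    ENNReal.ofReal (𝔼 i ∈ s, g i) ≤ B := by
  rcases s.eq_empty_or_nonempty with rfl | hs
  · simp
  have hc : (0 : ℝ) < s.card := by exact_mod_cast hs.card_pos
  rw [Finset.expect_eq_sum_div_card, ENNReal.ofReal_div_of_pos hc,
    ENNReal.ofReal_sum_of_nonneg fun i _ => hg i, ENNReal.ofReal_natCast]
  exact ENNReal.div_le_of_le_mul (by rwa [mul_comm] at h)

theorem invWeight_le_one {d : ℕ} {α : ℝ} (hα : 0 < α) {γ : ℕ → ℝ} (hγ1 : ∀ j, γ j ≤ 1)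
    (k : Fin d → ℤ) : invWeight α γ k ≤ 1 := by
  by_cases hk : k = 0
  · simp [hk, invWeight, korobovWeight]
  · obtain ⟨j, hj⟩ := Function.ne_iff.1 hk
    refine (invWeight_le_of_ne_zero hα hγ1 k j hj).trans ?_
    rw [ENNReal.ofReal_le_one]
    have h1 : (1 : ℝ) ≤ |(k j : ℝ)| := by exact_mod_cast Int.one_le_abs hj
    exact Real.rpow_le_one_of_one_le_of_nonpos h1 (by linarith)

theorem invWeightSum_anti {d : ℕ} {α : ℝ} (hα : 0 < α) {γ : ℕ → ℝ} (hγ1 : ∀ j, γ j ≤ 1)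
    {s t : ℝ} (hst : s ≤ t) : invWeightSum d α γ t ≤ invWeightSum d α γ s :=
  ENNReal.tsum_le_tsum fun k =>
    ENNReal.rpow_le_rpow_of_exponent_ge (invWeight_le_one hα hγ1 k) hst

theorem primeRange_bounds {M N : ℕ} (hN : N ∈ primeRange M) :
    N.Prime ∧ (M : ℝ) / 2 ≤ N ∧ (M : ℝ) / 4 ≤ (N - 1 : ℕ) := by
  obtain ⟨h1, hp⟩ := Finset.mem_filter.1 hN
  have h2 := (Finset.mem_Ioc.1 h1).1
  have h3 : (M : ℝ) / 2 ≤ N := (Nat.le_ceil _).trans (by exact_mod_cast h2.le)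
  refine ⟨hp, h3, ?_⟩
  have h4 : (2 : ℝ) ≤ N := by exact_mod_cast hp.two_le
  rw [Nat.cast_sub hp.one_lt.le]
  push_cast
  linarith

theorem sqrt_ofReal_le {x : ℝ≥0∞} {y : ℝ} (h : x ≤ ENNReal.ofReal y) (hy : 0 ≤ y) :
    x ^ (1 / 2 : ℝ) ≤ ENNReal.ofReal (√y) := by
  rw [Real.sqrt_eq_rpow, ← ENNReal.ofReal_rpow_of_nonneg hy (by norm_num)]
  gcongr

/-- Explicit bound for the expected error of an element of the unit ball. -/
theorem expected_error_le {d r : ℕ} {α : ℝ} {γ : ℕ → ℝ} (hγ1 : ∀ j, γ j ≤ 1) {η : ℝ}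
    (hη1 : η < 1) {lam : ℝ} (hlam : 1 / 2 < lam) (hlamα : lam < α) {K : ℝ}
    (hK : 0 < K) (hK1 : invWeightSum d α γ (1 / lam) ≤ ENNReal.ofReal K)
    (hK2 : invWeightSum d α γ (2 * lam / α) ≤ ENNReal.ofReal K) {C : ℝ} (hC0 : 0 < C)
    (hC : ∀ m : ℕ, (m : ℝ) * (2 : ℝ) ^ (-(α * (2 - 2 * lam / α) * m)) ≤ C)
    {f : (Fin d → ℝ) → ℝ} (hf : f ∈ korobovBall d α γ) {M : ℕ} (hM : 2 ≤ M)
    {sel : ℕ → (Fin r → Fin d → ℕ) → Fin r} (hsel : IsArgminRule d α γ r M sel) :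
    ENNReal.ofReal (𝔼 N ∈ primeRange M, 𝔼 z ∈ draws d r N,
      |cubeIntegral f - latticeRule N (z (sel N z)) f|) ≤
    ENNReal.ofReal ((1 - η) ^ r * √K +
      4 * r / M * √((8 * K / ((1 - η) * M)) ^ (2 * lam - 1) * K) +
      √(C * ((primeRange M).card * (((M : ℝ) / 2) ^ (-(2 * lam)) * K))) /
        (primeRange M).card) := by
  have hα : 0 < α := by linarith
  have hM0 : (0 : ℝ) < M := by exact_mod_cast (by omega : 0 < M)
  have h1η : 0 < 1 - η := by linarith
  set P := primeRange M
  have hP0 : (0 : ℝ) < P.card := by exact_mod_cast (primeRange_nonempty hM).card_pos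
  -- The Markov step needs 2K ≤ (1-η) T (N-1), and N - 1 ≥ M/4.
  set T : ℝ := 8 * K / ((1 - η) * M) with hTdef
  have hT0 : 0 < T := by positivity
  set E : ℕ → ℝ≥0∞ := fun N =>
    ∑' k, (multiples d N).indicator (fun k => ‖fourierCoefficient f k‖ₑ) k
  set X : ℝ := (1 - η) ^ r * √K + 4 * r / M * √(T ^ (2 * lam - 1) * K)
  set Y : ℝ := √(C * (P.card * (((M : ℝ) / 2) ^ (-(2 * lam)) * K)))
  have hX : 0 ≤ X := by positivity
  have hN : ∀ N ∈ P, ENNReal.ofReal (𝔼 z ∈ draws d r N,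
      |cubeIntegral f - latticeRule N (z (sel N z)) f|) ≤ ENNReal.ofReal X + E N := by
    intro N hNP
    obtain ⟨hp, -, hN4⟩ := primeRange_bounds hNP
    have hN0 : (0 : ℝ) < (N - 1 : ℕ) := lt_of_lt_of_le (by positivity) hN4
    refine ofReal_expect_le (fun _ => abs_nonneg _) ?_
    refine (sum_draws_error_le hα hf hp hlam hlamα.le (β := ENNReal.ofReal (1 - η))
      (T := ENNReal.ofReal T) (by simpa using hT0) ENNReal.ofReal_ne_top ?_ (sel N)
      (hsel N hNP)).trans ?_
    · calc _ ≤ 2 * ENNReal.ofReal K := by gcongr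
        _ = ENNReal.ofReal (2 * K) := by
          rw [ENNReal.ofReal_mul (by norm_num)]; simp
        _ ≤ ENNReal.ofReal ((1 - η) * T * (N - 1 : ℕ)) := by
          apply ENNReal.ofReal_le_ofReal
          have : (1 - η) * T * (N - 1 : ℕ) = 8 * K * (N - 1 : ℕ) / M := by
            rw [hTdef]; field_simp
          rw [this, le_div_iff₀ hM0]
          nlinarith
        _ = _ := by
          rw [ENNReal.ofReal_mul (by positivity), ENNReal.ofReal_mul (by positivity),
            ENNReal.ofReal_natCast]
    · gcongr
      simp only [X]
      rw [ENNReal.ofReal_add (by positivity) (by positivity), ENNReal.ofReal_mul (by positivity),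
        ENNReal.ofReal_mul (by positivity), ENNReal.ofReal_pow h1η.le]
      refine add_le_add (mul_le_mul' le_rfl ?_) (mul_le_mul' ?_ ?_)
      · refine sqrt_ofReal_le ((invWeightSum_anti hα hγ1 ?_).trans hK2) hK.le
        rw [div_le_iff₀ hα]; linarith
      · rw [← ENNReal.ofReal_natCast r, ← ENNReal.ofReal_natCast (N - 1),
          ← ENNReal.ofReal_div_of_pos hN0]
        apply ENNReal.ofReal_le_ofReal
        rw [div_le_div_iff₀ hN0 hM0]
        have : (0 : ℝ) ≤ r := by positivity
        nlinarith
      · refine sqrt_ofReal_le ?_ (by positivity)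
        rw [ENNReal.ofReal_mul (by positivity), ENNReal.ofReal_rpow_of_nonneg hT0.le (by linarith)]
        gcongr
  have hE : ∑ N ∈ P, E N ≤ ENNReal.ofReal Y := by
    refine (sum_multiples_le hα hγ1 hf (by linarith) hlamα hC P
      (fun p hp => (primeRange_bounds hp).1) (L := (M : ℝ) / 2) (by positivity)
      (fun p hp => (primeRange_bounds hp).2.1)).trans (sqrt_ofReal_le ?_ (by positivity))
    rw [ENNReal.ofReal_mul hC0.le, ENNReal.ofReal_mul hP0.le, ENNReal.ofReal_natCast,
      ENNReal.ofReal_mul (by positivity)]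
    gcongr
  refine ofReal_expect_le (fun _ => Finset.expect_nonneg fun _ _ => abs_nonneg _) ?_
  calc _ ≤ ∑ N ∈ P, (ENNReal.ofReal X + E N) := Finset.sum_le_sum hN
    _ = P.card * ENNReal.ofReal X + ∑ N ∈ P, E N := by
      rw [Finset.sum_add_distrib, Finset.sum_const, nsmul_eq_mul]
    _ ≤ P.card * ENNReal.ofReal X + ENNReal.ofReal Y := by gcongr
    _ = _ := by
      rw [ENNReal.ofReal_add hX (by positivity), mul_add, ← ENNReal.ofReal_natCast,
        ← ENNReal.ofReal_mul hP0.le (q := Y / _), mul_div_cancel₀ _ hP0.ne']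

theorem numDraws_bounds {α η : ℝ} (hα : 0 < α) (hη0 : 0 < η) (hη1 : η < 1) {M : ℕ}
    (hM : 2 ≤ M) :
    (1 - η) ^ numDraws α η M ≤ (M : ℝ) ^ (-(α + 1 / 2)) ∧
      (numDraws α η M : ℝ) ≤
        ((α + 1 / 2) / -Real.log (1 - η) + 1 / Real.log 2) * Real.log M := by
  have hMr : (2 : ℝ) ≤ M := by exact_mod_cast hM
  have hM0 : (0 : ℝ) < M := by linarith
  have hlneg : Real.log (1 - η) < 0 := Real.log_neg (by linarith) (by linarith)
  have hl2 : 0 < Real.log 2 := Real.log_pos (by norm_num)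
  have hlM : Real.log 2 ≤ Real.log M := Real.log_le_log (by norm_num) hMr
  have hx : -(α + 1 / 2) * Real.log M / Real.log (1 - η) =
      (α + 1 / 2) / -Real.log (1 - η) * Real.log M := by
    field_simp
  constructor
  · have h1 : -(α + 1 / 2) * Real.log M / Real.log (1 - η) ≤ numDraws α η M := Nat.le_ceil _
    rw [div_le_iff_of_neg hlneg] at h1
    rw [← Real.log_le_log_iff (pow_pos (by linarith) _) (by positivity), Real.log_pow,
      Real.log_rpow hM0]
    exact h1
  · have h2 : (numDraws α η M : ℝ) < -(α + 1 / 2) * Real.log M / Real.log (1 - η) + 1 := by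
      apply Nat.ceil_lt_add_one
      rw [hx]
      have : 0 < -Real.log (1 - η) := by linarith
      positivity
    rw [hx] at h2
    -- The +1 from the ceiling is absorbed into a multiple of log M, as M ≥ 2.
    have h3 : 1 ≤ 1 / Real.log 2 * Real.log M := by
      rw [one_div, ← div_eq_inv_mul, le_div_iff₀ hl2]; linarith
    linarith

/-- The constant depends on `d` and `γ` only through the bound `K`. -/
theorem exists_randomizedError_le {α η lam K : ℝ} (hη0 : 0 < η) (hη1 : η < 1)
    (hlam : 1 / 2 < lam) (hlamα : lam < α) (hK : 0 < K) :
    ∃ C : ℝ, 0 < C ∧ ∀ (d : ℕ) (γ : ℕ → ℝ), (∀ j, γ j ≤ 1) →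
      invWeightSum d α γ (1 / lam) ≤ ENNReal.ofReal K →
      invWeightSum d α γ (2 * lam / α) ≤ ENNReal.ofReal K →
      ∀ M : ℕ, 2 ≤ M → ∀ sel, IsArgminRule d α γ (numDraws α η M) M sel →
        randomizedError d α γ (numDraws α η M) M sel ≤
          ENNReal.ofReal (C * (M : ℝ) ^ (-lam - 1 / 2) * Real.log M) := by
  have hα : 0 < α := by linarith
  have h1η : 0 < 1 - η := by linarith
  have hl2 : 0 < Real.log 2 := Real.log_pos (by norm_num)
  have hlneg : 0 < -Real.log (1 - η) := by
    linarith [Real.log_neg (show 0 < 1 - η by linarith) (by linarith)]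
  obtain ⟨c, hc, hcP⟩ := exists_card_primeRange_ge
  have hτ : 0 < α * (2 - 2 * lam / α) := by
    apply mul_pos hα
    rw [sub_pos, div_lt_iff₀ hα]; linarith
  obtain ⟨C₀, hC₀, hC₀m⟩ := exists_nat_mul_rpow_le hτ
  set a := (α + 1 / 2) / -Real.log (1 - η) + 1 / Real.log 2
  -- `A`, `B` and `D` are the constants for bad draws, for small-weight frequencies that are hit,
  -- and for multiples of N.
  set A := √K / Real.log 2
  set B := 4 * a * √((8 * K / (1 - η)) ^ (2 * lam - 1) * K)
  set D := √(C₀ * K * 2 ^ (2 * lam) / (c * Real.log 2))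
  have ha : 0 < a := by positivity
  refine ⟨A + B + D, by positivity, fun d γ hγ1 hK1 hK2 M hM sel hsel => ?_⟩
  refine iSup₂_le fun f hf => ?_
  refine (expected_error_le hγ1 hη1 hlam hlamα hK hK1 hK2 hC₀ hC₀m hf hM hsel).trans
    (ENNReal.ofReal_le_ofReal ?_)
  have hMr : (2 : ℝ) ≤ M := by exact_mod_cast hM
  have hM0 : (0 : ℝ) < M := by linarith
  have hlM : Real.log 2 ≤ Real.log M := Real.log_le_log (by norm_num) hMr
  have hP := hcP M hM
  have hP0 : (0 : ℝ) < (primeRange M).card := by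
    exact_mod_cast (primeRange_nonempty hM).card_pos
  obtain ⟨hr1, hr2⟩ := numDraws_bounds hα hη0 hη1 hM
  generalize ((primeRange M).card : ℝ) = P at *
  generalize (numDraws α η M) = r at *
  set ℓ := Real.log M
  set y := (M : ℝ) ^ (-lam - 1 / 2) with hy
  have hy0 : 0 < y := by positivity
  have hℓ : 0 < ℓ := by linarith
  have t1 : (1 - η) ^ r * √K ≤ A * y * ℓ := by
    have h1 : (M : ℝ) ^ (-(α + 1 / 2)) ≤ y :=
      Real.rpow_le_rpow_of_exponent_le (by linarith) (by linarith)
    have h2 : 1 ≤ ℓ / Real.log 2 := by rw [le_div_iff₀ hl2]; linarith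
    calc (1 - η) ^ r * √K ≤ y * √K * 1 := by
          rw [mul_one]
          gcongr
          exact hr1.trans h1
      _ ≤ y * √K * (ℓ / Real.log 2) := by gcongr
      _ = _ := by simp only [A]; ring
  have t2 : 4 * r / M * √((8 * K / ((1 - η) * M)) ^ (2 * lam - 1) * K) ≤ B * y * ℓ := by
    have h1 : √((8 * K / ((1 - η) * M)) ^ (2 * lam - 1) * K) =
        √((8 * K / (1 - η)) ^ (2 * lam - 1) * K) * (M * y) := by
      have h2 : (8 * K / ((1 - η) * M)) ^ (2 * lam - 1) * K =
          ((8 * K / (1 - η)) ^ (2 * lam - 1) * K) * (M * y) ^ 2 := by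
        rw [← div_div, Real.div_rpow (by positivity) hM0.le, div_eq_mul_inv,
          ← Real.rpow_neg hM0.le]
        have h3 : (M * y) ^ 2 = (M : ℝ) ^ (-(2 * lam - 1)) := by
          have h4 : (M : ℝ) * y = (M : ℝ) ^ (1 + (-lam - 1 / 2)) := by
            rw [Real.rpow_add hM0, Real.rpow_one]
          rw [h4, ← Real.rpow_natCast, ← Real.rpow_mul hM0.le]
          congr 1
          push_cast
          ring
        rw [h3]
        ring
      rw [h2, Real.sqrt_mul (by positivity), Real.sqrt_sq (by positivity)]
    rw [h1]
    calc _ = 4 * r * √((8 * K / (1 - η)) ^ (2 * lam - 1) * K) * y := by field_simp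
      _ ≤ 4 * (a * ℓ) * √((8 * K / (1 - η)) ^ (2 * lam - 1) * K) * y := by gcongr
      _ = _ := by simp only [B]; ring
  have t3 : √(C₀ * (P * (((M : ℝ) / 2) ^ (-(2 * lam)) * K))) / P ≤ D * y * ℓ := by
    rw [div_le_iff₀ hP0]
    apply Real.sqrt_le_iff.2 ⟨by positivity, ?_⟩
    have h1 : ((M : ℝ) / 2) ^ (-(2 * lam)) = 2 ^ (2 * lam) * (M * y ^ 2) := by
      have h2 : (M : ℝ) * y ^ 2 = (M : ℝ) ^ (-(2 * lam)) := by
        rw [hy, ← Real.rpow_natCast, ← Real.rpow_mul hM0.le]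
        nth_rewrite 1 [← Real.rpow_one (M : ℝ)]
        rw [← Real.rpow_add hM0]
        congr 1
        push_cast
        ring
      rw [h2, Real.div_rpow hM0.le (by norm_num), Real.rpow_neg (x := 2) (by norm_num)]
      field_simp
    have hD : D ^ 2 = C₀ * K * 2 ^ (2 * lam) / (c * Real.log 2) := Real.sq_sqrt (by positivity)
    rw [div_le_iff₀ hℓ] at hP
    rw [h1, mul_pow, mul_pow, mul_pow, hD]
    -- The prime count costs one factor log M; the second comes from log 2 ≤ log M and makes the
    -- square root a full log M.
    have h4 : (M : ℝ) * (c * Real.log 2) ≤ ℓ ^ 2 * P := by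
      calc (M : ℝ) * (c * Real.log 2) = (c * M) * Real.log 2 := by ring
        _ ≤ (P * ℓ) * ℓ := by gcongr
        _ = _ := by ring
    calc C₀ * (P * (2 ^ (2 * lam) * (M * y ^ 2) * K))
        = (C₀ * K * 2 ^ (2 * lam) / (c * Real.log 2)) * y ^ 2 * P *
            (M * (c * Real.log 2)) := by field_simp
      _ ≤ (C₀ * K * 2 ^ (2 * lam) / (c * Real.log 2)) * y ^ 2 * P * (ℓ ^ 2 * P) := by gcongr
      _ = _ := by ring
  calc _ ≤ A * y * ℓ + B * y * ℓ + D * y * ℓ := add_le_add (add_le_add t1 t2) t3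
    _ = _ := by ring

/-- Passing from a rate with a logarithm to one with a slightly larger exponent. -/
theorem exists_mul_log_le {C ε : ℝ} (hC : 0 < C) (hε : 0 < ε) :
    ∃ C' : ℝ, 0 < C' ∧ ∀ (a : ℝ) (M : ℕ), 2 ≤ M →
      C * (M : ℝ) ^ a * Real.log M ≤ C' * (M : ℝ) ^ (a + ε) := by
  refine ⟨C / ε, by positivity, fun a M hM => ?_⟩
  have hM0 : (0 : ℝ) < M := by exact_mod_cast (by omega : 0 < M)
  have h := Real.log_le_rpow_div hM0.le hε
  rw [Real.rpow_add hM0]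
  calc _ ≤ C * (M : ℝ) ^ a * ((M : ℝ) ^ ε / ε) := by gcongr
    _ = _ := by ring

/-- Both rates follow, uniformly in a set of dimensions, from uniform bounds on `∑_k r(k)^{-s}`. -/
theorem exists_rates {α η : ℝ} (hα : 1 / 2 < α) (hη0 : 0 < η) (hη1 : η < 1) {γ : ℕ → ℝ}
    (hγ1 : ∀ j, γ j ≤ 1) (Ds : Set ℕ)
    (hbd : ∀ s, 1 / α < s → ∃ K : ℝ, ∀ d ∈ Ds, invWeightSum d α γ s ≤ ENNReal.ofReal K) :
    (∀ lam δ : ℝ, 1 / 2 < lam → lam < α → 0 < δ →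
      ∃ C : ℝ, 0 < C ∧ ∀ d ∈ Ds, ErrorBoundedBy d α γ η
        (fun M => C * (M : ℝ) ^ (-lam + δ - 1 / 2) * Real.log M)) ∧
    (∀ ε : ℝ, 0 < ε → ∃ C : ℝ, 0 < C ∧ ∀ d ∈ Ds, ErrorBoundedBy d α γ η
        (fun M => C * (M : ℝ) ^ (-α - 1 / 2 + ε))) := by
  have hα0 : 0 < α := by linarith
  have core : ∀ lam : ℝ, 1 / 2 < lam → lam < α → ∃ C : ℝ, 0 < C ∧ ∀ d ∈ Ds, ∀ M : ℕ, 2 ≤ M →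
      ∀ sel, IsArgminRule d α γ (numDraws α η M) M sel →
        randomizedError d α γ (numDraws α η M) M sel ≤
          ENNReal.ofReal (C * (M : ℝ) ^ (-lam - 1 / 2) * Real.log M) := by
    intro lam h1 h2
    -- Both exponents exceed 1/α: the first because λ < α, the second because 2λ > 1.
    obtain ⟨K₁, hK₁⟩ := hbd (1 / lam) (one_div_lt_one_div_of_lt (by linarith) h2)
    obtain ⟨K₂, hK₂⟩ := hbd (2 * lam / α) (by gcongr; linarith)
    obtain ⟨C, hC, h⟩ := exists_randomizedError_le (K := max 1 (max K₁ K₂)) hη0 hη1 h1 h2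
      (lt_max_of_lt_left one_pos)
    exact ⟨C, hC, fun d hd => h d γ hγ1
      ((hK₁ d hd).trans (ENNReal.ofReal_le_ofReal (by simp)))
      ((hK₂ d hd).trans (ENNReal.ofReal_le_ofReal (by simp)))⟩
  constructor
  · intro lam δ h1 h2 hδ
    obtain ⟨C, hC, h⟩ := core lam h1 h2
    refine ⟨C, hC, fun d hd M hM _ sel hsel => (h d hd M hM sel hsel).trans
      (ENNReal.ofReal_le_ofReal ?_)⟩
    have hMr : (1 : ℝ) ≤ M := by exact_mod_cast (by omega : 1 ≤ M)
    have hlog := Real.log_nonneg hMr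
    beta_reduce
    gcongr
    linarith
  · intro ε hε
    -- Half of ε pays for λ < α and half for the logarithm; the midpoint of 1/2 and α keeps λ above
    -- 1/2 when ε is large.
    have hlam : max ((1 / 2 + α) / 2) (α - ε / 2) < α := max_lt (by linarith) (by linarith)
    obtain ⟨C, hC, h⟩ := core _ (lt_max_of_lt_left (by linarith)) hlam
    obtain ⟨C', hC', h'⟩ := exists_mul_log_le hC (half_pos hε)
    refine ⟨C', hC', fun d hd M hM _ sel hsel => (h d hd M hM sel hsel).trans
      (ENNReal.ofReal_le_ofReal ((h' _ M hM).trans ?_))⟩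
    have hMr : (1 : ℝ) ≤ M := by exact_mod_cast (by omega : 1 ≤ M)
    have := le_max_right ((1 / 2 + α) / 2) (α - ε / 2)
    exact mul_le_mul_of_nonneg_left (Real.rpow_le_rpow_of_exponent_le hMr (by linarith)) hC'.le

end LatticeRule

end

theorem corollary3p4 (α : ℝ) (hα : 1 / 2 < α) (γ : ℕ → ℝ)
    (hγ0 : ∀ j, 0 ≤ γ j) (hγ1 : ∀ j, γ j ≤ 1) (η : ℝ) (hη0 : 0 < η) (hη1 : η < 1) :
    -- the rate, in every dimension
    (∀ (d : ℕ) (lam δ : ℝ), 1 / 2 < lam → lam < α → 0 < δ → δ < min (lam - 1 / 2) 1 →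
      ∃ C : ℝ, 0 < C ∧ LatticeRule.ErrorBoundedBy d α γ η
        (fun M => C * (M : ℝ) ^ (-lam + δ - 1 / 2) * Real.log M)) ∧
    -- the rate is arbitrarily close to `M ^ (-α - 1/2)`
    Tendsto (fun p : ℝ × ℝ => -p.1 + p.2 - 1 / 2) (𝓝[<] α ×ˢ 𝓝[>] 0) (𝓝 (-α - 1 / 2)) ∧
    (∀ (d : ℕ) (ε : ℝ), 0 < ε →
      ∃ C : ℝ, 0 < C ∧ LatticeRule.ErrorBoundedBy d α γ η
        (fun M => C * (M : ℝ) ^ (-α - 1 / 2 + ε))) ∧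
    -- under summability of the weights, the constants do not depend on the dimension
    (Summable (fun j => γ j ^ (1 / α)) →
      (∀ lam δ : ℝ, 1 / 2 < lam → lam < α → 0 < δ → δ < min (lam - 1 / 2) 1 →
        ∃ C : ℝ, 0 < C ∧ ∀ d : ℕ, LatticeRule.ErrorBoundedBy d α γ η
          (fun M => C * (M : ℝ) ^ (-lam + δ - 1 / 2) * Real.log M)) ∧
      (∀ ε : ℝ, 0 < ε →
        ∃ C : ℝ, 0 < C ∧ ∀ d : ℕ, LatticeRule.ErrorBoundedBy d α γ η
          (fun M => C * (M : ℝ) ^ (-α - 1 / 2 + ε)))) := by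
  have hα0 : 0 < α := by linarith
  have hs : ∀ s, 1 / α < s → 0 < s ∧ 1 < α * s := fun s h =>
    ⟨lt_trans (by positivity) h, by rwa [div_lt_iff₀' hα0] at h⟩
  have fixed : ∀ d : ℕ, ∀ s, 1 / α < s → ∃ K : ℝ, ∀ d' ∈ ({d} : Set ℕ),
      LatticeRule.invWeightSum d' α γ s ≤ ENNReal.ofReal K := by
    intro d s h
    refine ⟨∏ j : Fin d, (1 + γ j ^ s * LatticeRule.intZeta (α * s)), ?_⟩
    rintro _ rfl
    exact (LatticeRule.invWeightSum_eq hγ0 (hs s h).1 (hs s h).2).le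
  refine ⟨fun d lam δ h1 h2 h3 _ => ?_, ?_, fun d ε hε => ?_, fun hsum => ?_⟩
  · obtain ⟨C, hC, h⟩ := (LatticeRule.exists_rates hα hη0 hη1 hγ1 {d} (fixed d)).1 lam δ h1 h2 h3
    exact ⟨C, hC, h d rfl⟩
  · have h1 : Tendsto (fun p : ℝ × ℝ => -p.1 + p.2 - 1 / 2) (𝓝 (α, 0)) (𝓝 (-α + 0 - 1 / 2)) :=
      Continuous.tendsto (by fun_prop) (α, (0 : ℝ))
    rw [add_zero, nhds_prod_eq] at h1
    exact h1.mono_left (Filter.prod_mono nhdsWithin_le_nhds nhdsWithin_le_nhds)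
  · obtain ⟨C, hC, h⟩ := (LatticeRule.exists_rates hα hη0 hη1 hγ1 {d} (fixed d)).2 ε hε
    exact ⟨C, hC, h d rfl⟩
  · have unif : ∀ s, 1 / α < s → ∃ K : ℝ, ∀ d' ∈ (univ : Set ℕ),
        LatticeRule.invWeightSum d' α γ s ≤ ENNReal.ofReal K := by
      intro s h
      refine ⟨_, fun d _ => LatticeRule.invWeightSum_le_of_summable hγ0 (hs s h).1 (hs s h).2
        (hsum.of_nonneg_of_le (fun j => Real.rpow_nonneg (hγ0 j) _) fun j => ?_) d⟩
      -- As γ_j ≤ 1, summability at the exponent 1/α passes to every s > 1/α.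
      exact Real.rpow_le_rpow_of_exponent_ge' (hγ0 j) (hγ1 j) (by positivity) h.le
    have hr := LatticeRule.exists_rates hα hη0 hη1 hγ1 univ unif
    refine ⟨fun lam δ h1 h2 h3 _ => ?_, fun ε hε => ?_⟩
    · obtain ⟨C, hC, h⟩ := hr.1 lam δ h1 h2 h3
      exact ⟨C, hC, fun d => h d (mem_univ d)⟩
    · obtain ⟨C, hC, h⟩ := hr.2 ε hε
      exact ⟨C, hC, fun d => h d (mem_univ d)⟩
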